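/- Let $\mathfrak g$ be a finite-dimensional simple complex Lie algebra of simply laced type, $\mathfrak h$ a Cartan subalgebra, $\alpha_1,\dots,\alpha_s$ simple roots with coroots $\alpha_p^\vee\in\mathfrak h$, $\Delta_+$ the set of positive roots, and $(\cdot|\cdot)$ a nondegenerate symmetric invariant bilinear form on $\mathfrak g$. Let $$\mathfrak T'=\mathfrak g\otimes\mathbb C[t_1^{\pm1},t_2^{\pm1}]\oplus\mathbb Cc_1\oplus\mathbb Cc_2\oplus\mathbb Cd_1$$ be the Lie algebra with $c_1,c_2$ central, $[d_1,x(m,n)]=m\,x(m,n)$ and $$[x(m_1,m_2),y(n_1,n_2)]=[x,y](m_1+n_1,m_2+n_2)+(x|y)\,\delta_{m_1,-n_1}\delta_{m_2,-n_2}(m_1c_1+m_2c_2),$$ where $x(m,n)=x\otimes t_1^mt_2^n$. Put $\mathfrak T'_0=\mathfrak h\otimes\mathbb C[t_2^{\pm1}]\oplus\mathbb Cc_1\oplus\mathbb Cc_2\oplus\mathbb Cd_1$, and let $\mathfrak T_+$ be spanned by all $x(m,n)$ with $x\in\mathfrak g$, $m>0$, $n\in\mathbb Z$, and all $x(0,n)$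 with $x\in\mathfrak g_\alpha$, $\alpha\in\Delta_+$, $n\in\mathbb Z$. For a linear functional $\lambda$ on $\mathfrak T'_0$ with $\lambda(c_1)=\lambda(c_2)=0$, let $M(\lambda)$ be the $\mathfrak T'$-module induced from the one-dimensional $(\mathfrak T'_0\oplus\mathfrak T_+)$-module on which $\mathfrak T'_0$ acts by $\lambda$ and $\mathfrak T_+$ acts by $0$, and let $L(\lambda)$ be its unique irreducible quotient, that is, the quotient of $M(\lambda)$ by the sum of all its proper submodules. Let $\mathcal S_1,\mathcal S_2$ be coprime ideals of finite codimension in $\mathbb C[t_2^{\pm1}]$, and let $\lambda,\mu$ be linear functionals on $\mathfrak T'_0$ vanishing on $c_1$ and $c_2$, such that for each $p=1,\dots,s$ there are finitely many $\lambda_{p,i},\mu_{p,j}\in\mathbb Z_{\ge0}$ and $a_{p,i},b_{p,j}\in\mathbb C^\times$ with $$\lambda(\alpha_p^\vee(0,n))=\sum_i\lambda_{p,i}\,a_{p,i}^n,\qquad \mu(\alpha_p^\vee(0,n))=\sum_j\mu_{p,j}\,b_{p,j}^n\qquad(n\in\mathbb Z),$$ and such that $\lambda(\alpha_p^\vee\otimes\mathcal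 S_1)=0$ and $\mu(\alpha_p^\vee\otimes\mathcal S_2)=0$ for $p=1,\dots,s$. Then $L(\lambda+\mu)\cong L(\lambda)\otimes L(\mu)$ as $\mathfrak T'$-modules. -/

import Mathlib

open scoped TensorProduct LaurentPolynomial

noncomputable section

namespace DoubleAffine

/-- The ring `ℂ[t₁^{±1}, t₂^{±1}]` of Laurent polynomials in two commuting variables. -/
abbrev Laurent₂ : Type := AddMonoidAlgebra ℂ (ℤ × ℤ)

/-- The monomial `t₁^m t₂^n`. -/
def mono (m n : ℤ) : Laurent₂ := AddMonoidAlgebra.single (m, n) 1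

/-- The inclusion `ℂ[t₂^{±1}] → ℂ[t₁^{±1}, t₂^{±1}]`, sending `t₂^n` to `t₁^0 t₂^n`. -/
def inclT₂ : ℂ[T;T⁻¹] →ₐ[ℂ] Laurent₂ :=
  AddMonoidAlgebra.mapDomainAlgHom ℂ ℂ (AddMonoidHom.inr ℤ ℤ)

/-- The degree derivation `t₁^m t₂^n ↦ χ(m, n) t₁^m t₂^n`. -/
def deg (χ : ℤ × ℤ →+ ℤ) : Laurent₂ →ₗ[ℂ] Laurent₂ :=
  (AddMonoidAlgebra.coeffLinearEquiv ℂ).symm.toLinearMap ∘ₗ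
    Finsupp.lsum ℂ (fun m : ℤ × ℤ => (χ m : ℂ) • Finsupp.lsingle (R := ℂ) (M := ℂ) m) ∘ₗ
      (AddMonoidAlgebra.coeffLinearEquiv ℂ).toLinearMap

/-- `t₁ ∂/∂t₁`. -/
abbrev deg₁ : Laurent₂ →ₗ[ℂ] Laurent₂ := deg (AddMonoidHom.fst ℤ ℤ)

/-- `t₂ ∂/∂t₂`. -/
abbrev deg₂ : Laurent₂ →ₗ[ℂ] Laurent₂ := deg (AddMonoidHom.snd ℤ ℤ)

/-- The constant coefficient of a Laurent polynomial. -/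
def constCoeff : Laurent₂ →ₗ[ℂ] ℂ :=
  Finsupp.lapply (0 : ℤ × ℤ) ∘ₗ (AddMonoidAlgebra.coeffLinearEquiv ℂ).toLinearMap

lemma deg_single (χ : ℤ × ℤ →+ ℤ) (m : ℤ × ℤ) (r : ℂ) :
    deg χ (AddMonoidAlgebra.single m r) = AddMonoidAlgebra.single m ((χ m : ℂ) * r) := by
  apply (AddMonoidAlgebra.coeffLinearEquiv ℂ).injective
  simp [deg]

lemma constCoeff_single (m : ℤ × ℤ) (r : ℂ) :
    constCoeff (AddMonoidAlgebra.single m r) = if m = 0 then r else 0 := by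
  simp [constCoeff, Finsupp.single_apply]

lemma deg_mul (χ : ℤ × ℤ →+ ℤ) (a b : Laurent₂) : deg χ (a * b) = deg χ a * b + a * deg χ b := by
  induction a using AddMonoidAlgebra.induction_linear with
  | zero => simp
  | add x y hx hy => simp only [add_mul, map_add, hx, hy]; abel
  | single m r =>
    induction b using AddMonoidAlgebra.induction_linear with
    | zero => simp
    | add x y hx hy => simp only [mul_add, map_add, hx, hy]; abel
    | single n s =>
      simp only [AddMonoidAlgebra.single_mul_single, deg_single, map_add, Int.cast_add,
        ← AddMonoidAlgebra.single_add]
      congr 1; ring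

lemma constCoeff_deg (χ : ℤ × ℤ →+ ℤ) (a : Laurent₂) : constCoeff (deg χ a) = 0 := by
  induction a using AddMonoidAlgebra.induction_linear with
  | zero => simp
  | add x y hx hy => simp [hx, hy]
  | single m r =>
    rw [deg_single, constCoeff_single]
    split_ifs with h
    · simp [h]
    · rfl

/-- The bilinear form `(a, b) ↦` constant coefficient of `(deg χ a) * b`; on monomials it is
`(t^m, t^n) ↦ χ(m) δ_{m,-n}`. -/
def residue (χ : ℤ × ℤ →+ ℤ) : LinearMap.BilinForm ℂ Laurent₂ :=
  (LinearMap.mul ℂ Laurent₂).compr₂ constCoeff ∘ₗ deg χ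

lemma residue_apply (χ : ℤ × ℤ →+ ℤ) (a b : Laurent₂) :
    residue χ a b = constCoeff (deg χ a * b) := rfl

lemma residue_mono (χ : ℤ × ℤ →+ ℤ) (m n : ℤ × ℤ) :
    residue χ (mono m.1 m.2) (mono n.1 n.2) = if m + n = 0 then (χ m : ℂ) else 0 := by
  simp [residue_apply, mono, deg_single, AddMonoidAlgebra.single_mul_single, constCoeff_single]

lemma residue_swap (χ : ℤ × ℤ →+ ℤ) (a b : Laurent₂) : residue χ a b = - residue χ b a := by
  have h := constCoeff_deg χ (a * b)
  rw [deg_mul, map_add] at h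
  rw [residue_apply, residue_apply, mul_comm (deg χ b) a]
  linear_combination h

lemma residue_cyclic (χ : ℤ × ℤ →+ ℤ) (a b c : Laurent₂) :
    residue χ (a * b) c + residue χ (b * c) a + residue χ (c * a) b = 0 := by
  have h := constCoeff_deg χ (a * b * c)
  simp only [deg_mul, residue_apply, add_mul, map_add] at h ⊢
  rw [show deg χ b * c * a = a * deg χ b * c by ring, show b * deg χ c * a = a * b * deg χ c by ring,
    show deg χ c * a * b = a * b * deg χ c by ring, show c * deg χ a * b = deg χ a * b * c by ring]
  linear_combination 2 * h

lemma deg_comm (χ ψ : ℤ × ℤ →+ ℤ) (a : Laurent₂) : deg χ (deg ψ a) = deg ψ (deg χ a) := by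
  induction a using AddMonoidAlgebra.induction_linear with
  | zero => simp
  | add x y hx hy => simp [hx, hy]
  | single m r => simp only [deg_single]; congr 1; ring

lemma residue_deg (χ ψ : ℤ × ℤ →+ ℤ) (a b : Laurent₂) :
    residue χ (deg ψ a) b + residue χ a (deg ψ b) = 0 := by
  have h := constCoeff_deg ψ (deg χ a * b)
  rw [deg_mul, map_add, deg_comm] at h
  exact h

section Algebra

variable (g : Type*) [LieRing g] [LieAlgebra ℂ g]

/-- A nondegenerate symmetric invariant bilinear form on a complex Lie algebra. -/
structure InvariantForm where
  form : LinearMap.BilinForm ℂ g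
  symm : ∀ x y, form x y = form y x
  invariant : form.lieInvariant g
  nondegenerate : form.Nondegenerate

/-- The two-variable loop algebra `g ⊗ ℂ[t₁^{±1}, t₂^{±1}]`. -/
def Loop₂ : Type _ := Laurent₂ ⊗[ℂ] g

instance : LieRing (Loop₂ g) := inferInstanceAs (LieRing (Laurent₂ ⊗[ℂ] g))

instance : LieAlgebra ℂ (Loop₂ g) := inferInstanceAs (LieAlgebra ℂ (Laurent₂ ⊗[ℂ] g))

variable {g}

/-- The underlying vector space of the two-variable loop algebra is the tensor product. -/
def loopEquiv : Loop₂ g ≃ₗ[ℂ] Laurent₂ ⊗[ℂ] g where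
  toFun u := u
  invFun u := u
  map_add' _ _ := rfl
  map_smul' _ _ := rfl
  left_inv _ := rfl
  right_inv _ := rfl

/-- The element `x ⊗ a` of the two-variable loop algebra. -/
def tens (a : Laurent₂) (x : g) : Loop₂ g := loopEquiv.symm (a ⊗ₜ[ℂ] x)

lemma loop_induction {P : Loop₂ g → Prop} (u : Loop₂ g) (zero : P 0)
    (tens : ∀ a x, P (tens a x)) (add : ∀ u v, P u → P v → P (u + v)) : P u :=
  TensorProduct.induction_on (motive := fun u => P (loopEquiv.symm u)) u zero tens add

lemma lie_tens (a b : Laurent₂) (x y : g) : ⁅tens a x, tens b y⁆ = tens (a * b) ⁅x, y⁆ := rfl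

lemma add_tens (a b : Laurent₂) (x : g) : tens (a + b) x = tens a x + tens b x :=
  TensorProduct.add_tmul a b x

/-- The derivation `x ⊗ a ↦ x ⊗ deg χ a` of the two-variable loop algebra. -/
def loopDeg (χ : ℤ × ℤ →+ ℤ) : Loop₂ g →ₗ[ℂ] Loop₂ g :=
  loopEquiv.symm.toLinearMap ∘ₗ (deg χ).rTensor g ∘ₗ loopEquiv.toLinearMap

lemma loopDeg_tens (χ : ℤ × ℤ →+ ℤ) (a : Laurent₂) (x : g) :
    loopDeg χ (tens a x) = tens (deg χ a) x := rfl

/-- The two-cocycle `(x ⊗ t^m, y ⊗ t^n) ↦ (x|y) χ(m) δ_{m,-n}`. -/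
def cocycle (B : InvariantForm g) (χ : ℤ × ℤ →+ ℤ) : LinearMap.BilinForm ℂ (Loop₂ g) :=
  (LinearMap.BilinForm.tmul (residue χ) B.form).compl₁₂ loopEquiv.toLinearMap loopEquiv.toLinearMap

lemma cocycle_tens (B : InvariantForm g) (χ : ℤ × ℤ →+ ℤ) (a b : Laurent₂) (x y : g) :
    cocycle B χ (tens a x) (tens b y) = B.form x y * residue χ a b := rfl

lemma InvariantForm.cyclic (B : InvariantForm g) (x y z : g) :
    B.form ⁅x, y⁆ z = B.form ⁅y, z⁆ x := by
  rw [← lie_skew, map_neg, LinearMap.neg_apply, B.invariant, neg_neg, B.symm]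

lemma cocycle_swap (B : InvariantForm g) (χ : ℤ × ℤ →+ ℤ) (u v : Loop₂ g) :
    cocycle B χ u v = - cocycle B χ v u := by
  induction u using loop_induction with
  | zero => simp
  | add x y hx hy => simp only [map_add, LinearMap.add_apply, hx, hy]; ring
  | tens a x =>
    induction v using loop_induction with
    | zero => simp
    | add x y hx hy => simp only [map_add, LinearMap.add_apply, hx, hy]; ring
    | tens b y =>
      rw [cocycle_tens, cocycle_tens, residue_swap, B.symm x y]; ring

lemma cocycle_self (B : InvariantForm g) (χ : ℤ × ℤ →+ ℤ) (u : Loop₂ g) :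
    cocycle B χ u u = 0 := by
  have h := cocycle_swap B χ u u
  linear_combination h / 2

lemma cocycle_cyclic (B : InvariantForm g) (χ : ℤ × ℤ →+ ℤ) (u v w : Loop₂ g) :
    cocycle B χ ⁅u, v⁆ w + cocycle B χ ⁅v, w⁆ u + cocycle B χ ⁅w, u⁆ v = 0 := by
  induction u using loop_induction with
  | zero => simp
  | add x y hx hy =>
    simp only [map_add, LinearMap.add_apply, add_lie, lie_add]; linear_combination hx + hy
  | tens a x =>
    induction v using loop_induction with
    | zero => simp
    | add x y hx hy =>
      simp only [map_add, LinearMap.add_apply, add_lie, lie_add]; linear_combination hx + hy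
    | tens b y =>
      induction w using loop_induction with
      | zero => simp
      | add x y hx hy =>
        simp only [map_add, LinearMap.add_apply, add_lie, lie_add]; linear_combination hx + hy
      | tens c z =>
        simp only [lie_tens, cocycle_tens]
        rw [← B.cyclic y z x, ← B.cyclic x y z]
        linear_combination B.form ⁅x, y⁆ z * residue_cyclic χ a b c

lemma cocycle_loopDeg (B : InvariantForm g) (χ ψ : ℤ × ℤ →+ ℤ) (u v : Loop₂ g) :
    cocycle B χ (loopDeg ψ u) v + cocycle B χ u (loopDeg ψ v) = 0 := by
  induction u using loop_induction with
  | zero => simp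
  | add x y hx hy => simp only [map_add, LinearMap.add_apply]; linear_combination hx + hy
  | tens a x =>
    induction v using loop_induction with
    | zero => simp
    | add x y hx hy => simp only [map_add]; linear_combination hx + hy
    | tens b y =>
      simp only [loopDeg_tens, cocycle_tens]
      linear_combination B.form x y * residue_deg χ ψ a b

lemma loopDeg_lie (χ : ℤ × ℤ →+ ℤ) (u v : Loop₂ g) :
    loopDeg χ ⁅u, v⁆ = ⁅loopDeg χ u, v⁆ + ⁅u, loopDeg χ v⁆ := by
  induction u using loop_induction with
  | zero => simp
  | add x y hx hy => simp only [map_add, add_lie, hx, hy]; abel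
  | tens a x =>
    induction v using loop_induction with
    | zero => simp
    | add x y hx hy => simp only [map_add, lie_add, hx, hy]; abel
    | tens b y =>
      simp only [loopDeg_tens, lie_tens, deg_mul, add_tens]

/-- The vector space `g ⊗ ℂ[t₁^{±1}, t₂^{±1}] ⊕ ℂ c₁ ⊕ ℂ c₂ ⊕ ℂ d₁`: the two-variable loop algebra,
its two-dimensional centre and the first degree derivation. -/
def Toroidal (_B : InvariantForm g) : Type _ := Loop₂ g × ℂ × ℂ × ℂ

variable (B : InvariantForm g)

instance : AddCommGroup (Toroidal B) := inferInstanceAs (AddCommGroup (Loop₂ g × ℂ × ℂ × ℂ))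

instance : Module ℂ (Toroidal B) := inferInstanceAs (Module ℂ (Loop₂ g × ℂ × ℂ × ℂ))

namespace Toroidal

variable {B}

/-- The element `u + p c₁ + q c₂ + r d₁`. -/
def mk (u : Loop₂ g) (p q r : ℂ) : Toroidal B := (u, p, q, r)

/-- The component in the two-variable loop algebra. -/
def loop (X : Toroidal B) : Loop₂ g := X.1

/-- The coefficient of `c₁`. -/
def coeffC₁ (X : Toroidal B) : ℂ := X.2.1

/-- The coefficient of `c₂`. -/
def coeffC₂ (X : Toroidal B) : ℂ := X.2.2.1

/-- The coefficient of `d₁`. -/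
def coeffD₁ (X : Toroidal B) : ℂ := X.2.2.2

@[ext] lemma ext {X Y : Toroidal B} (h : X.loop = Y.loop) (h₁ : X.coeffC₁ = Y.coeffC₁)
    (h₂ : X.coeffC₂ = Y.coeffC₂) (h₃ : X.coeffD₁ = Y.coeffD₁) : X = Y :=
  Prod.ext h (Prod.ext h₁ (Prod.ext h₂ h₃))

@[simp] lemma loop_mk (u : Loop₂ g) (p q r : ℂ) : (mk u p q r : Toroidal B).loop = u := rfl
@[simp] lemma coeffC₁_mk (u : Loop₂ g) (p q r : ℂ) : (mk u p q r : Toroidal B).coeffC₁ = p := rfl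
@[simp] lemma coeffC₂_mk (u : Loop₂ g) (p q r : ℂ) : (mk u p q r : Toroidal B).coeffC₂ = q := rfl
@[simp] lemma coeffD₁_mk (u : Loop₂ g) (p q r : ℂ) : (mk u p q r : Toroidal B).coeffD₁ = r := rfl
@[simp] lemma loop_zero : (0 : Toroidal B).loop = 0 := rfl
@[simp] lemma coeffC₁_zero : (0 : Toroidal B).coeffC₁ = 0 := rfl
@[simp] lemma coeffC₂_zero : (0 : Toroidal B).coeffC₂ = 0 := rfl
@[simp] lemma coeffD₁_zero : (0 : Toroidal B).coeffD₁ = 0 := rfl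
@[simp] lemma loop_add (X Y : Toroidal B) : (X + Y).loop = X.loop + Y.loop := rfl
@[simp] lemma coeffC₁_add (X Y : Toroidal B) : (X + Y).coeffC₁ = X.coeffC₁ + Y.coeffC₁ := rfl
@[simp] lemma coeffC₂_add (X Y : Toroidal B) : (X + Y).coeffC₂ = X.coeffC₂ + Y.coeffC₂ := rfl
@[simp] lemma coeffD₁_add (X Y : Toroidal B) : (X + Y).coeffD₁ = X.coeffD₁ + Y.coeffD₁ := rfl
@[simp] lemma loop_smul (r : ℂ) (X : Toroidal B) : (r • X).loop = r • X.loop := rfl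
@[simp] lemma coeffC₁_smul (r : ℂ) (X : Toroidal B) : (r • X).coeffC₁ = r * X.coeffC₁ := rfl
@[simp] lemma coeffC₂_smul (r : ℂ) (X : Toroidal B) : (r • X).coeffC₂ = r * X.coeffC₂ := rfl
@[simp] lemma coeffD₁_smul (r : ℂ) (X : Toroidal B) : (r • X).coeffD₁ = r * X.coeffD₁ := rfl

/-- The bracket: `c₁`, `c₂` are central, `[d₁, x ⊗ t₁^m t₂^n] = m x ⊗ t₁^m t₂^n`, and
`[x ⊗ t^m, y ⊗ t^n] = [x, y] ⊗ t^{m+n} + (x|y) δ_{m,-n} (m₁ c₁ + m₂ c₂)`. -/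
instance : Bracket (Toroidal B) (Toroidal B) where
  bracket X Y := mk
    (⁅X.loop, Y.loop⁆ + X.coeffD₁ • loopDeg (AddMonoidHom.fst ℤ ℤ) Y.loop
      - Y.coeffD₁ • loopDeg (AddMonoidHom.fst ℤ ℤ) X.loop)
    (cocycle B (AddMonoidHom.fst ℤ ℤ) X.loop Y.loop)
    (cocycle B (AddMonoidHom.snd ℤ ℤ) X.loop Y.loop)
    0

lemma lie_def (X Y : Toroidal B) : ⁅X, Y⁆ = mk
    (⁅X.loop, Y.loop⁆ + X.coeffD₁ • loopDeg (AddMonoidHom.fst ℤ ℤ) Y.loop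
      - Y.coeffD₁ • loopDeg (AddMonoidHom.fst ℤ ℤ) X.loop)
    (cocycle B (AddMonoidHom.fst ℤ ℤ) X.loop Y.loop)
    (cocycle B (AddMonoidHom.snd ℤ ℤ) X.loop Y.loop)
    0 := rfl

lemma cocycle_jacobi (χ ψ : ℤ × ℤ →+ ℤ) (x y z : Loop₂ g) (p q r : ℂ) :
    cocycle B χ x (⁅y, z⁆ + q • loopDeg ψ z - r • loopDeg ψ y) =
      cocycle B χ (⁅x, y⁆ + p • loopDeg ψ y - q • loopDeg ψ x) z +
        cocycle B χ y (⁅x, z⁆ + p • loopDeg ψ z - r • loopDeg ψ x) := by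
  simp only [map_add, map_sub, map_smul, LinearMap.add_apply, LinearMap.sub_apply,
    LinearMap.smul_apply, smul_eq_mul]
  have h := cocycle_cyclic B χ x y z
  rw [cocycle_swap B χ x ⁅y, z⁆, cocycle_swap B χ y ⁅x, z⁆]
  rw [← lie_skew z x, map_neg, LinearMap.neg_apply] at h
  have h₁ := cocycle_loopDeg B χ ψ x z
  have h₂ := cocycle_loopDeg B χ ψ y z
  have h₃ := cocycle_loopDeg B χ ψ x y
  rw [cocycle_swap B χ (loopDeg ψ x) y] at h₃
  linear_combination (-1 : ℂ) * h + q * h₁ - p * h₂ - r * h₃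

instance : LieRing (Toroidal B) where
  add_lie X Y Z := by
    ext <;> simp [lie_def, add_smul]
    abel
  lie_add X Y Z := by
    ext <;> simp [lie_def, add_smul]
    abel
  lie_self X := by
    ext <;> simp [lie_def, cocycle_self]
  leibniz_lie X Y Z := by
    ext
    · simp only [lie_def, loop_mk, loop_add, coeffD₁_mk, lie_add, lie_sub, add_lie, sub_lie, map_add,
        map_sub, map_smul, loopDeg_lie, lie_smul, smul_lie, zero_smul, smul_add, smul_sub]
      rw [leibniz_lie X.loop Y.loop Z.loop,
        ← lie_skew (loopDeg (AddMonoidHom.fst ℤ ℤ) X.loop) Y.loop, smul_neg]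
      rw [smul_comm X.coeffD₁ Y.coeffD₁, smul_comm X.coeffD₁ Z.coeffD₁,
        smul_comm Y.coeffD₁ Z.coeffD₁]
      abel
    · simpa [lie_def] using! cocycle_jacobi _ _ X.loop Y.loop Z.loop _ _ _
    · simpa [lie_def] using! cocycle_jacobi _ _ X.loop Y.loop Z.loop _ _ _
    · simp [lie_def]

instance : LieAlgebra ℂ (Toroidal B) where
  lie_smul r X Y := by
    ext
    · simp only [lie_def, loop_mk, loop_smul, coeffD₁_smul, lie_smul, map_smul, smul_add, smul_sub,
        mul_smul]
      rw [smul_comm X.coeffD₁ r]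
    all_goals simp [lie_def]

end Toroidal

/-- The element `x ⊗ a` of the Lie algebra `Toroidal B`. -/
def elt (B : InvariantForm g) (x : g) (a : Laurent₂) : Toroidal B := Toroidal.mk (tens a x) 0 0 0

/-- The central element `c₁`. -/
def c₁ (B : InvariantForm g) : Toroidal B := Toroidal.mk 0 1 0 0

/-- The central element `c₂`. -/
def c₂ (B : InvariantForm g) : Toroidal B := Toroidal.mk 0 0 1 0

/-- The degree derivation `d₁`. -/
def d₁ (B : InvariantForm g) : Toroidal B := Toroidal.mk 0 0 0 1

lemma d₁_lie_elt (B : InvariantForm g) (x : g) (m n : ℤ) :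
    ⁅d₁ B, elt B x (mono m n)⁆ = (m : ℂ) • elt B x (mono m n) := by
  have h : deg (AddMonoidHom.fst ℤ ℤ) (mono m n) = (m : ℂ) • mono m n := by
    simp [mono, deg_single, AddMonoidAlgebra.smul_single]
  ext
  · simp only [Toroidal.lie_def, d₁, elt, Toroidal.loop_mk, Toroidal.coeffD₁_mk, zero_lie, zero_add,
      one_smul, zero_smul, sub_zero, loopDeg_tens, h, Toroidal.loop_smul]
    rfl
  all_goals simp [Toroidal.lie_def, d₁, elt]

lemma c₁_lie (B : InvariantForm g) (X : Toroidal B) : ⁅c₁ B, X⁆ = 0 := by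
  ext <;> simp [Toroidal.lie_def, c₁]

lemma c₂_lie (B : InvariantForm g) (X : Toroidal B) : ⁅c₂ B, X⁆ = 0 := by
  ext <;> simp [Toroidal.lie_def, c₂]

lemma elt_lie_elt (B : InvariantForm g) (x y : g) (m₁ m₂ n₁ n₂ : ℤ) :
    ⁅elt B x (mono m₁ m₂), elt B y (mono n₁ n₂)⁆ =
      elt B ⁅x, y⁆ (mono (m₁ + n₁) (m₂ + n₂)) +
        (if m₁ + n₁ = 0 ∧ m₂ + n₂ = 0 then B.form x y else 0) •
          ((m₁ : ℂ) • c₁ B + (m₂ : ℂ) • c₂ B) := by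
  have h₁ := residue_mono (AddMonoidHom.fst ℤ ℤ) (m₁, m₂) (n₁, n₂)
  have h₂ := residue_mono (AddMonoidHom.snd ℤ ℤ) (m₁, m₂) (n₁, n₂)
  simp only [Prod.mk_add_mk, Prod.mk_eq_zero, AddMonoidHom.coe_fst, AddMonoidHom.coe_snd] at h₁ h₂
  ext
  · split_ifs <;> simp [Toroidal.lie_def, elt, c₁, c₂, lie_tens, mono, AddMonoidAlgebra.single_mul_single]
  · simp only [Toroidal.lie_def, elt, c₁, c₂, Toroidal.loop_mk, Toroidal.coeffC₁_mk, cocycle_tens, h₁,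
      Toroidal.coeffC₁_add, Toroidal.coeffC₁_smul]
    split_ifs <;> simp
  · simp only [Toroidal.lie_def, elt, c₁, c₂, Toroidal.loop_mk, Toroidal.coeffC₂_mk, cocycle_tens, h₂,
      Toroidal.coeffC₂_add, Toroidal.coeffC₂_smul]
    split_ifs <;> simp
  · split_ifs <;> simp [Toroidal.lie_def, elt, c₁, c₂]

end Algebra

section HighestWeight

open LieAlgebra LieAlgebra.IsKilling

variable {g : Type*} [LieRing g] [LieAlgebra ℂ g] (B : InvariantForm g) (H : LieSubalgebra ℂ g)

/-- The subspace `h ⊗ ℂ[t₂^{±1}] ⊕ ℂ c₁ ⊕ ℂ c₂ ⊕ ℂ d₁`. -/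
def zeroPart : Submodule ℂ (Toroidal B) :=
  Submodule.span ℂ ({X | ∃ h ∈ H, ∃ f : ℂ[T;T⁻¹], X = elt B h (inclT₂ f)} ∪ {c₁ B, c₂ B, d₁ B})

namespace zeroPart

variable {H}

/-- The element `h ⊗ f(t₂)` of `zeroPart B H`. -/
def cartan (h : H) (f : ℂ[T;T⁻¹]) : zeroPart B H :=
  ⟨elt B (h : g) (inclT₂ f), Submodule.subset_span (Or.inl ⟨h, h.2, f, rfl⟩)⟩

variable (H)

/-- `c₁` as an element of `zeroPart B H`. -/
def c₁ : zeroPart B H := ⟨DoubleAffine.c₁ B, Submodule.subset_span (Or.inr (by simp))⟩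

/-- `c₂` as an element of `zeroPart B H`. -/
def c₂ : zeroPart B H := ⟨DoubleAffine.c₂ B, Submodule.subset_span (Or.inr (by simp))⟩

end zeroPart

variable [FiniteDimensional ℂ g] [IsKilling ℂ g] {H} [H.IsCartanSubalgebra]
  (b : (rootSystem H).Base)

/-- The sum of the root spaces for the roots `α + m δ₁ + n δ₂` where `n` is any integer and
`α + m δ₁` is a positive root of the affine Lie algebra in the variable `t₁`, that is, `m > 0` and
`α` is a root or zero, or `m = 0` and `α` is a positive root. -/
def posPart : Submodule ℂ (Toroidal B) :=
  Submodule.span ℂ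
    ({X | ∃ (x : g) (m n : ℤ), 0 < m ∧ X = elt B x (mono m n)} ∪
      {X | ∃ (α : H.root) (x : g) (n : ℤ), b.IsPos α ∧ x ∈ rootSpace H (α : LieModule.Weight ℂ H g) ∧
        X = elt B x (mono 0 n)})

/-- The left ideal of the universal enveloping algebra generated by `posPart B b` and by all
`h - λ(h)` with `h` in `zeroPart B H`. -/
def vermaIdeal (lam : Module.Dual ℂ (zeroPart B H)) :
    Submodule (UniversalEnvelopingAlgebra ℂ (Toroidal B))
      (UniversalEnvelopingAlgebra ℂ (Toroidal B)) :=
  Submodule.span _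
    ({u | ∃ X ∈ posPart B b, u = UniversalEnvelopingAlgebra.ι ℂ X} ∪
      {u | ∃ X : zeroPart B H, u = UniversalEnvelopingAlgebra.ι ℂ (X : Toroidal B) -
        algebraMap ℂ (UniversalEnvelopingAlgebra ℂ (Toroidal B)) (lam X)})

/-- The module `M(λ)` induced from the one-dimensional module `ℂ 1_λ` over
`zeroPart B H ⊕ posPart B b`, on which `posPart B b` acts by zero and `zeroPart B H` acts by `λ`.
It is the quotient of the enveloping algebra by the left ideal which the annihilator of `1_λ`
generates. -/
abbrev Verma (lam : Module.Dual ℂ (zeroPart B H)) : Type _ :=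
  UniversalEnvelopingAlgebra ℂ (Toroidal B) ⧸ vermaIdeal B b lam

/-- The sum of all proper submodules of `M(λ)`. -/
def maxSubmodule (lam : Module.Dual ℂ (zeroPart B H)) :
    Submodule (UniversalEnvelopingAlgebra ℂ (Toroidal B)) (Verma B b lam) :=
  sSup {N | N ≠ ⊤}

/-- The irreducible quotient `L(λ)` of `M(λ)`. -/
def Irr (lam : Module.Dual ℂ (zeroPart B H)) : Type _ :=
  Verma B b lam ⧸ maxSubmodule B b lam

variable (lam : Module.Dual ℂ (zeroPart B H))

instance : AddCommGroup (Irr B b lam) :=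
  inferInstanceAs (AddCommGroup (Verma B b lam ⧸ maxSubmodule B b lam))

instance : Module (UniversalEnvelopingAlgebra ℂ (Toroidal B)) (Irr B b lam) :=
  inferInstanceAs (Module (UniversalEnvelopingAlgebra ℂ (Toroidal B))
    (Verma B b lam ⧸ maxSubmodule B b lam))

instance : Module ℂ (Irr B b lam) :=
  inferInstanceAs (Module ℂ (Verma B b lam ⧸ maxSubmodule B b lam))

instance : IsScalarTower ℂ (UniversalEnvelopingAlgebra ℂ (Toroidal B)) (Irr B b lam) :=
  inferInstanceAs (IsScalarTower ℂ (UniversalEnvelopingAlgebra ℂ (Toroidal B))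
    (Verma B b lam ⧸ maxSubmodule B b lam))

/-- `Toroidal B` acts on `L(λ)` through its enveloping algebra. -/
instance : LieRingModule (Toroidal B) (Irr B b lam) where
  bracket X v := UniversalEnvelopingAlgebra.ι ℂ X • v
  add_lie X Y v := by
    change UniversalEnvelopingAlgebra.ι ℂ (X + Y) • v = _
    rw [map_add, add_smul]
  lie_add X v w := smul_add _ v w
  leibniz_lie X Y v := by
    change UniversalEnvelopingAlgebra.ι ℂ X • UniversalEnvelopingAlgebra.ι ℂ Y • v =
      UniversalEnvelopingAlgebra.ι ℂ ⁅X, Y⁆ • v +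
        UniversalEnvelopingAlgebra.ι ℂ Y • UniversalEnvelopingAlgebra.ι ℂ X • v
    let _ : LieRing (UniversalEnvelopingAlgebra ℂ (Toroidal B)) := LieRing.ofAssociativeRing
    rw [LieHom.map_lie, LieRing.of_associative_ring_bracket, sub_smul, mul_smul, mul_smul,
      sub_add_cancel]

instance : LieModule ℂ (Toroidal B) (Irr B b lam) where
  smul_lie r X v := by
    change UniversalEnvelopingAlgebra.ι ℂ (r • X) • v = r • UniversalEnvelopingAlgebra.ι ℂ X • v
    rw [map_smul, smul_assoc]
  lie_smul r X v := by
    change UniversalEnvelopingAlgebra.ι ℂ X • r • v = r • UniversalEnvelopingAlgebra.ι ℂ X • v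
    rw [← algebraMap_smul (UniversalEnvelopingAlgebra ℂ (Toroidal B)) r v,
      ← algebraMap_smul (UniversalEnvelopingAlgebra ℂ (Toroidal B)) r
        (UniversalEnvelopingAlgebra.ι ℂ X • v), ← mul_smul, ← mul_smul, Algebra.commutes]

/-- The conditions on the highest weight: `λ(c₁) = λ(c₂) = 0`, and for every simple root `α_p` there
are finitely many nonnegative integers `λ_{p,i}` and nonzero complex numbers `a_{p,i}` with
`λ(α_p^∨ ⊗ t₂^n) = ∑ᵢ λ_{p,i} a_{p,i}^n` for all integers `n`. -/
def IsExpPolynomial (lam : Module.Dual ℂ (zeroPart B H)) : Prop :=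
  lam (zeroPart.c₁ B H) = 0 ∧ lam (zeroPart.c₂ B H) = 0 ∧
    ∀ p ∈ b.support, ∃ (k : ℕ) (m : Fin k → ℕ) (a : Fin k → ℂˣ), ∀ n : ℤ,
      lam (zeroPart.cartan B ((rootSystem H).coroot p) (LaurentPolynomial.T n)) =
        ∑ i, (m i : ℂ) * ((a i ^ n : ℂˣ) : ℂ)

/-- `S` is an ideal of `ℂ[t₂^{±1}]` associated with `λ`: `λ(α_p^∨ ⊗ S) = 0` for all simple roots
`α_p`. -/
def Annihilates (S : Ideal ℂ[T;T⁻¹]) (lam : Module.Dual ℂ (zeroPart B H)) : Prop :=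
  ∀ p ∈ b.support, ∀ f ∈ S, lam (zeroPart.cartan B ((rootSystem H).coroot p) f) = 0

end HighestWeight

end DoubleAffine

end

/-! Everything is read off one grading. Let `ρ` in the Cartan subalgebra take the value of the
height on each root, let `K` exceed all absolute heights, and put `D = K d₁ + ρ`. On `x ⊗ t₁^m t₂^n`
with `x` in a root space of root `α`, `ad D` has the eigenvalue `K m + ht α`, whose sign is that of
`m`, or of `α` when `m = 0`. Hence the zero eigenspace is `zeroPart`, the positive eigenspaces add
up to `posPart` (`eq_of_sup_eq_top`), and `L(λ)` is an irreducible highest weight module for `D`,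
with `D`-eigenvalues `c, c - 1, c - 2, ...` and top eigenspace spanned by the highest weight vector
`v`.

Coprimality decouples the factors. If `λ` vanishes on `h ⊗ S₁` and on the centre, the ideal `I`
spanned by `g ⊗ ℂ[t₁^{±1}] ⊗ S₁`, `c₁` and `c₂` maps `v` to strictly lower eigenvalues. The subspace
`I v` is stable under the nonnegative part, so the submodule it generates misses `v` and is zero;
the annihilator of `I` is then a submodule containing `v`, and `I` kills `L(λ)`
(`lie_eq_zero_of_mem_ideal`, `loopIdeal_lie_irr`). Write `1 = e₁ + e₂` with `eᵢ ∈ Sᵢ`. Then `x ⊗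
t₁^m t₂^n e₂` acts on `L(λ)` like `x ⊗ t₁^m t₂^n` and on `L(μ)` by zero (`exists_separating`). So
everything without a `d₁`-component can act on the first factor alone.

A nonzero submodule of `L(λ) ⊗ L(μ)` is therefore stable under the positive part acting on the first
factor. This action is locally nilpotent and its invariants in `L(λ)` are `ℂ v`, so the submodule
contains some `v ⊗ y ≠ 0`. Irreducibility of `L(μ)` gives `v ⊗ L(μ)`, and generation by `v` gives
everything; the missing direction `d₁` is recovered from `D`, for which `v` is an eigenvector
(`tensor_irreducible`). The product of the highest weight vectors has weight `λ + μ`, and the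
universal property of `M(λ + μ)` concludes (`nonempty_irr_equiv`).

It remains to see that `M(λ) ≠ 0`. Brackets in `zeroPart` are multiples of `c₂`, so `λ(c₂) = 0`
makes `λ` a character, and the induced module is realized by explicit operators on the enveloping
algebra of the negative part (`one_notMem_span`). -/

namespace GradedLie

/-! ### Eigenspaces of an element `D` and the grading they induce -/

section Weights

variable {G : Type*} [LieRing G] [LieAlgebra ℂ G] (D : G)
variable (M : Type*) [AddCommGroup M] [Module ℂ M] [LieRingModule G M] [LieModule ℂ G M]

/-- The eigenspace of `D` on `M` for the eigenvalue `r`. -/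
def wt (r : ℂ) : Submodule ℂ M := (LieModule.toEnd ℂ G M D).eigenspace r

/-- The sum of the eigenspaces of `ad D` for the positive integers. -/
def posG : Submodule ℂ G := ⨆ j : ℕ, wt D G (j + 1)

/-- The sum of the eigenspaces of `ad D` for the negative integers. -/
def negG : Submodule ℂ G := ⨆ j : ℕ, wt D G (-(j + 1))

/-- The sum of the eigenspaces of `D` on `M` for the eigenvalues `c - 1`, `c - 2`, .... -/
def lower (c : ℂ) : Submodule ℂ M := ⨆ k : ℕ, wt D M (c - (k + 1))

variable {D M}

lemma mem_wt {r : ℂ} {m : M} : m ∈ wt D M r ↔ ⁅D, m⁆ = r • m :=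
  Module.End.mem_eigenspace_iff

lemma lie_mem_wt {r s : ℂ} {X : G} {m : M} (hX : X ∈ wt D G r) (hm : m ∈ wt D M s) :
    ⁅X, m⁆ ∈ wt D M (r + s) := by
  rw [mem_wt] at *
  rw [leibniz_lie, hX, hm, smul_lie, lie_smul, add_smul]

lemma self_mem_wt : D ∈ wt D G 0 := by
  rw [mem_wt, lie_self, zero_smul]

lemma lie_lower_of_wt {c r : ℂ} {X : G} (hX : X ∈ wt D G r) {W : Submodule ℂ M}
    (h : ∀ k : ℕ, wt D M (r + (c - (k + 1))) ≤ W) {w : M} (hw : w ∈ lower D M c) : ⁅X, w⁆ ∈ W := by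
  suffices lower D M c ≤ W.comap (LieModule.toEnd ℂ G M X) from this hw
  exact iSup_le fun k m hm => h k (lie_mem_wt hX hm)

lemma lie_mem_of_iSup {ι : Type*} {A : ι → Submodule ℂ G} {X : G} (hX : X ∈ ⨆ i, A i) {m : M}
    {W : Submodule ℂ M} (h : ∀ i, ∀ Y ∈ A i, ⁅Y, m⁆ ∈ W) : ⁅X, m⁆ ∈ W := by
  suffices (⨆ i, A i) ≤ W.comap ((LieModule.toEnd ℂ G M : G →ₗ[ℂ] Module.End ℂ M).flip m) from
    this hX
  exact iSup_le fun i Y hY => h i Y hY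

lemma zero_lie_lower {c : ℂ} {X : G} (hX : X ∈ wt D G 0) {w : M} (hw : w ∈ lower D M c) :
    ⁅X, w⁆ ∈ lower D M c :=
  lie_lower_of_wt hX (fun k => by
    rw [zero_add]
    exact le_iSup (fun k : ℕ => wt D M (c - (k + 1))) k) hw

lemma neg_lie_lower {c : ℂ} {X : G} (hX : X ∈ negG D) {w : M} (hw : w ∈ lower D M c) :
    ⁅X, w⁆ ∈ lower D M c :=
  lie_mem_of_iSup hX fun j Y hY => lie_lower_of_wt hY (fun k => by
    refine le_trans (le_of_eq ?_) (le_iSup (fun k : ℕ => wt D M (c - (k + 1))) (k + j + 1))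
    congr 1; push_cast; ring) hw

lemma neg_lie_wt {c : ℂ} {X : G} (hX : X ∈ negG D) {w : M} (hw : w ∈ wt D M c) :
    ⁅X, w⁆ ∈ lower D M c :=
  lie_mem_of_iSup hX fun j Y hY => by
    refine le_iSup (fun k : ℕ => wt D M (c - (k + 1))) j ?_
    convert lie_mem_wt hY hw using 1
    congr 1; ring

lemma zero_lie_posG {X Y : G} (hX : X ∈ wt D G 0) (hY : Y ∈ posG D) : ⁅X, Y⁆ ∈ posG D := by
  suffices posG D ≤ (posG D).comap (LieModule.toEnd ℂ G G X) from this hY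
  refine iSup_le fun j m hm => le_iSup (fun j : ℕ => wt D G (j + 1)) j ?_
  simpa using lie_mem_wt hX hm

lemma posG_lie_posG {X Y : G} (hX : X ∈ posG D) (hY : Y ∈ posG D) : ⁅X, Y⁆ ∈ posG D := by
  refine lie_mem_of_iSup hX fun i Z hZ => ?_
  suffices posG D ≤ (posG D).comap (LieModule.toEnd ℂ G G Z) from this hY
  refine iSup_le fun j m hm => le_iSup (fun j : ℕ => wt D G (j + 1)) (i + j + 1) ?_
  change ⁅Z, m⁆ ∈ _
  convert lie_mem_wt hZ hm using 1
  congr 1; push_cast; ring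

lemma negG_lie_negG {X Y : G} (hX : X ∈ negG D) (hY : Y ∈ negG D) : ⁅X, Y⁆ ∈ negG D := by
  refine lie_mem_of_iSup hX fun i Z hZ => ?_
  suffices negG D ≤ (negG D).comap (LieModule.toEnd ℂ G G Z) from this hY
  refine iSup_le fun j m hm => le_iSup (fun j : ℕ => wt D G (-(j + 1))) (i + j + 1) ?_
  change ⁅Z, m⁆ ∈ _
  convert lie_mem_wt hZ hm using 1
  congr 1; push_cast; ring

/-- The eigenspace for `c` meets the sum of any family of other eigenspaces trivially. -/
lemma disjoint_wt_iSup {ι : Type*} (c : ℂ) (f : ι → ℂ) (h : ∀ i, f i ≠ c) :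
    Disjoint (wt D M c) (⨆ i, wt D M (f i)) :=
  ((LieModule.toEnd ℂ G M D).eigenspaces_iSupIndep c).mono_right
    (iSup_le fun i => le_iSup₂_of_le (f i) (h i) le_rfl)

lemma disjoint_wt_lower (c : ℂ) : Disjoint (wt D M c) (lower D M c) :=
  disjoint_wt_iSup c _ fun k h => by
    have : ((k : ℂ) + 1) = 0 := by linear_combination -h
    exact Nat.cast_add_one_ne_zero k this

/-- A subspace stable under the nonnegative part of `G` generates a submodule inside every
subspace containing it that is stable under the negative part of `G`. -/
lemma exists_lieSubmodule_le (htop : negG D ⊔ wt D G 0 ⊔ posG D = ⊤) {S₀ W : Submodule ℂ M}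
    (h₀ : S₀ ≤ W) (hW : ∀ X ∈ negG D, ∀ w ∈ W, ⁅X, w⁆ ∈ W)
    (hz : ∀ X ∈ wt D G 0, ∀ s ∈ S₀, ⁅X, s⁆ ∈ S₀) (hp : ∀ X ∈ posG D, ∀ s ∈ S₀, ⁅X, s⁆ ∈ S₀) :
    ∃ S : LieSubmodule ℂ G M, S₀ ≤ S.toSubmodule ∧ S.toSubmodule ≤ W := by
  let T : Submodule ℂ M := sInf {S | S₀ ≤ S ∧ ∀ X ∈ negG D, ∀ w ∈ S, ⁅X, w⁆ ∈ S}
  have hT₀ : S₀ ≤ T := le_sInf fun S hS => hS.1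
  have hTn : ∀ X ∈ negG D, ∀ w ∈ T, ⁅X, w⁆ ∈ T := fun X hX w hw =>
    (Submodule.mem_sInf).2 fun S hS => hS.2 X hX w ((Submodule.mem_sInf).1 hw S hS)
  have hTW : T ≤ W := sInf_le ⟨h₀, hW⟩
  -- `T` is the smallest subspace containing `S₀` that is stable under `negG D`. The part `Q` of `T`
  -- that all of `G` maps into `T` contains `S₀` and is again stable, since `Y X w = [Y, X] w + X Y
  -- w`; minimality gives `T ≤ Q`.
  let Q : Submodule ℂ M :=
    { carrier := {w | w ∈ T ∧ ∀ X : G, ⁅X, w⁆ ∈ T}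
      add_mem' := fun ha hb => ⟨add_mem ha.1 hb.1, fun X => by
        rw [lie_add]; exact add_mem (ha.2 X) (hb.2 X)⟩
      zero_mem' := ⟨zero_mem _, fun X => by rw [lie_zero]; exact zero_mem _⟩
      smul_mem' := fun r a ha => ⟨T.smul_mem r ha.1, fun X => by
        rw [lie_smul]; exact T.smul_mem r (ha.2 X)⟩ }
  have hQ : T ≤ Q := sInf_le ⟨fun s hs => ⟨hT₀ hs, fun X => by
      have hX : X ∈ negG D ⊔ wt D G 0 ⊔ posG D := htop ▸ Submodule.mem_top
      obtain ⟨Y, hY, P, hP, rfl⟩ := Submodule.mem_sup.1 hX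
      obtain ⟨N, hN, Z, hZ, rfl⟩ := Submodule.mem_sup.1 hY
      rw [add_lie, add_lie]
      exact add_mem (add_mem (hTn N hN s (hT₀ hs)) (hT₀ (hz Z hZ s hs))) (hT₀ (hp P hP s hs))⟩,
    fun X hX w hw => ⟨hTn X hX w hw.1, fun Y => by
      rw [leibniz_lie]
      exact add_mem (hw.2 _) (hTn X hX _ (hw.2 Y))⟩⟩
  exact ⟨{ T with lie_mem := fun {X m} hm => (hQ hm).2 X }, hT₀, hTW⟩

end Weights

/-! ### Highest weight modules for the grading -/

section HighestWeight

variable {G : Type*} [LieRing G] [LieAlgebra ℂ G]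
variable {M : Type*} [AddCommGroup M] [Module ℂ M] [LieRingModule G M] [LieModule ℂ G M]

/-- `M` is generated by the nonzero vector `v`, which `posG D` annihilates and on which the
centralizer of `D` acts through `chi`. -/
structure IsHighestWeight (D : G) (chi : G →ₗ[ℂ] ℂ) (v : M) : Prop where
  ne_zero : v ≠ 0
  pos : ∀ X ∈ posG D, ⁅X, v⁆ = 0
  zero : ∀ X ∈ wt D G 0, ⁅X, v⁆ = chi X • v
  gen : ∀ S : LieSubmodule ℂ G M, v ∈ S → S = ⊤

namespace IsHighestWeight

variable {D : G} {chi : G →ₗ[ℂ] ℂ} {v : M} (hv : IsHighestWeight D chi v)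
  (htop : negG D ⊔ wt D G 0 ⊔ posG D = ⊤)

include hv

lemma mem_wt : v ∈ wt D M (chi D) :=
  GradedLie.mem_wt.2 (hv.zero D self_mem_wt)

lemma notMem_lower : v ∉ lower D M (chi D) := fun h =>
  hv.ne_zero (Submodule.disjoint_def.1 (disjoint_wt_lower (chi D)) v hv.mem_wt h)

include htop

/-- The line through `v` is stable under the nonnegative part, so the submodule it generates, which
is all of `M`, stays inside any subspace containing it that the negative part preserves. -/
lemma span_sup_lower : Submodule.span ℂ {v} ⊔ lower D M (chi D) = ⊤ := by
  obtain ⟨S, hS, hSW⟩ := exists_lieSubmodule_le (S₀ := Submodule.span ℂ {v})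
    (W := Submodule.span ℂ {v} ⊔ lower D M (chi D)) htop le_sup_left
    (fun X hX w hw => by
      obtain ⟨a, ha, l, hl, rfl⟩ := Submodule.mem_sup.1 hw
      obtain ⟨r, rfl⟩ := Submodule.mem_span_singleton.1 ha
      rw [lie_add, lie_smul]
      exact Submodule.mem_sup_right (add_mem (Submodule.smul_mem _ _ (neg_lie_wt hX hv.mem_wt))
        (neg_lie_lower hX hl)))
    (fun X hX w hw => by
      obtain ⟨r, rfl⟩ := Submodule.mem_span_singleton.1 hw
      rw [lie_smul, hv.zero X hX]
      exact Submodule.smul_mem _ _ (Submodule.smul_mem _ _ (Submodule.mem_span_singleton_self v)))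
    (fun X hX w hw => by
      obtain ⟨r, rfl⟩ := Submodule.mem_span_singleton.1 hw
      rw [lie_smul, hv.pos X hX, smul_zero]
      exact zero_mem _)
  have := hv.gen S (hS (Submodule.mem_span_singleton_self v))
  subst this
  exact top_le_iff.1 hSW

lemma exists_eq_smul_add (x : M) : ∃ (a : ℂ) (w : M), w ∈ lower D M (chi D) ∧ x = a • v + w := by
  have hx : x ∈ Submodule.span ℂ {v} ⊔ lower D M (chi D) := hv.span_sup_lower htop ▸ Submodule.mem_top
  obtain ⟨a, ha, w, hw, rfl⟩ := Submodule.mem_sup.1 hx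
  obtain ⟨r, rfl⟩ := Submodule.mem_span_singleton.1 ha
  exact ⟨r, w, hw, rfl⟩

omit hv htop in
open Polynomial in
-- A vector of `lower` is a finite sum of eigenvectors with eigenvalues other than `c`; the product
-- of the corresponding linear factors in `D` kills it. This replaces projections to eigenspaces.
lemma exists_aeval_eq_zero {c : ℂ} {w : M} (hw : w ∈ lower D M c) :
    ∃ q : ℂ[X], q.eval c ≠ 0 ∧ aeval (LieModule.toEnd ℂ G M D) q w = 0 := by
  induction hw using Submodule.iSup_induction' with
  | mem k x hx =>
    refine ⟨X - C (c - (k + 1)), ?_, ?_⟩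
    · simpa using Nat.cast_add_one_ne_zero k
    · rw [map_sub, aeval_X, aeval_C, LinearMap.sub_apply, Module.algebraMap_end_apply,
        LieModule.toEnd_apply_apply, GradedLie.mem_wt.1 hx, sub_self]
  | zero => exact ⟨1, by simp, by simp⟩
  | add x y _ _ hx hy =>
    obtain ⟨p, hp, hpx⟩ := hx
    obtain ⟨q, hq, hqy⟩ := hy
    refine ⟨p * q, by simp [hp, hq], ?_⟩
    rw [map_add, map_mul, Module.End.mul_apply, Module.End.mul_apply, hqy, map_zero, add_zero,
      ← Module.End.mul_apply, ← map_mul, mul_comm, map_mul, Module.End.mul_apply, hpx, map_zero]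

/-- A proper submodule has no component along the highest weight vector. -/
lemma le_lower_of_ne_top {N : LieSubmodule ℂ G M} (hN : N ≠ ⊤) :
    N.toSubmodule ≤ lower D M (chi D) := by
  intro x hx
  obtain ⟨a, w, hw, rfl⟩ := hv.exists_eq_smul_add htop x
  by_cases ha : a = 0
  · simpa [ha] using hw
  · exfalso
    -- Applying `q(D)` removes `w` and multiplies `v` by a nonzero number, so `N` would contain `v`.
    obtain ⟨q, hq, hqw⟩ := exists_aeval_eq_zero hw
    have h1 : Polynomial.aeval (LieModule.toEnd ℂ G M D) q (a • v + w) ∈ N.toSubmodule :=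
      Polynomial.aeval_apply_smul_mem_of_le_comap hx q _ fun y hy => N.lie_mem hy
    rw [map_add, hqw, add_zero, map_smul,
      Module.End.aeval_apply_of_mem_apply_eq_smul (GradedLie.mem_wt.1 hv.mem_wt), smul_smul] at h1
    refine hN (hv.gen N ?_)
    exact (Submodule.smul_mem_iff _ (mul_ne_zero ha hq)).1 h1


/-- Since the negative part preserves `lower`, the submodule generated by `S₀` stays there and
misses `v`; irreducibility forces it to vanish. -/
lemma eq_bot_of_le_lower (hirr : ∀ S : LieSubmodule ℂ G M, S = ⊥ ∨ S = ⊤) {S₀ : Submodule ℂ M}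
    (h₀ : S₀ ≤ lower D M (chi D)) (hz : ∀ X ∈ wt D G 0, ∀ s ∈ S₀, ⁅X, s⁆ ∈ S₀)
    (hp : ∀ X ∈ posG D, ∀ s ∈ S₀, ⁅X, s⁆ ∈ S₀) : S₀ = ⊥ := by
  obtain ⟨S, hS, hSW⟩ := exists_lieSubmodule_le htop h₀ (fun X hX w hw => neg_lie_lower hX hw) hz hp
  rcases hirr S with rfl | rfl
  · exact le_bot_iff.1 hS
  · exact absurd (hSW (LieSubmodule.mem_top v)) hv.notMem_lower

/-- The vectors of an irreducible highest weight module that `posG D` annihilates. -/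
lemma mem_span_of_pos (hirr : ∀ S : LieSubmodule ℂ G M, S = ⊥ ∨ S = ⊤) {x : M}
    (hx : ∀ X ∈ posG D, ⁅X, x⁆ = 0) : x ∈ Submodule.span ℂ {v} := by
  obtain ⟨a, w, hw, rfl⟩ := hv.exists_eq_smul_add htop x
  have hw' : ∀ X ∈ posG D, ⁅X, w⁆ = 0 := fun X hX => by
    simpa [hv.pos X hX] using hx X hX
  -- Invariants of `posG D` are preserved by the centralizer of `D`, which normalizes `posG D`; so
  -- those in `lower` vanish.
  let S₀ : Submodule ℂ M :=
    { carrier := {y | y ∈ lower D M (chi D) ∧ ∀ X ∈ posG D, ⁅X, y⁆ = 0}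
      add_mem' := fun ha hb => ⟨add_mem ha.1 hb.1, fun X hX => by
        rw [lie_add, ha.2 X hX, hb.2 X hX, add_zero]⟩
      zero_mem' := ⟨zero_mem _, fun X _ => lie_zero X⟩
      smul_mem' := fun r a ha => ⟨Submodule.smul_mem _ r ha.1, fun X hX => by
        rw [lie_smul, ha.2 X hX, smul_zero]⟩ }
  have hS₀ : S₀ = ⊥ := hv.eq_bot_of_le_lower htop hirr (fun y hy => hy.1)
    (fun X hX s hs => ⟨zero_lie_lower hX hs.1, fun Y hY => by
      rw [leibniz_lie, hs.2 Y hY, lie_zero, add_zero, ← lie_skew, neg_lie,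
        hs.2 _ (zero_lie_posG hX hY), neg_zero]⟩)
    (fun X hX s hs => by rw [hs.2 X hX]; exact zero_mem _)
  have : w ∈ S₀ := ⟨hw, hw'⟩
  rw [hS₀, Submodule.mem_bot] at this
  rw [this, add_zero]
  exact Submodule.smul_mem _ _ (Submodule.mem_span_singleton_self v)

/-- An ideal that maps the highest weight vector of an irreducible module to lower weights
annihilates the module. -/
lemma lie_eq_zero_of_mem_ideal (hirr : ∀ S : LieSubmodule ℂ G M, S = ⊥ ∨ S = ⊤) {I : LieIdeal ℂ G}
    (hI : ∀ X ∈ I, ⁅X, v⁆ ∈ lower D M (chi D)) {X : G} (hX : X ∈ I) (x : M) : ⁅X, x⁆ = 0 := by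
  let S₀ : Submodule ℂ M :=
    I.toSubmodule.map ((LieModule.toEnd ℂ G M : G →ₗ[ℂ] Module.End ℂ M).flip v)
  have hmem : ∀ Y ∈ I, ⁅Y, v⁆ ∈ S₀ := fun Y hY => ⟨Y, hY, rfl⟩
  have hS₀ : S₀ = ⊥ := by
    -- In `Z Y v = [Z, Y] v + Y Z v` the first term is in `I v` because `I` is an ideal, and `Z v`
    -- is a multiple of `v` for `Z` of nonnegative degree.
    refine hv.eq_bot_of_le_lower htop hirr ?_ ?_ ?_
    · rintro _ ⟨Y, hY, rfl⟩
      exact hI Y hY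
    · rintro Z hZ _ ⟨Y, hY, rfl⟩
      change ⁅Z, ⁅Y, v⁆⁆ ∈ S₀
      rw [leibniz_lie, hv.zero Z hZ, lie_smul]
      exact add_mem (hmem _ (lie_mem_right ℂ G I Z Y hY)) (Submodule.smul_mem _ _ (hmem Y hY))
    · rintro Z hZ _ ⟨Y, hY, rfl⟩
      change ⁅Z, ⁅Y, v⁆⁆ ∈ S₀
      rw [leibniz_lie, hv.pos Z hZ, lie_zero, add_zero]
      exact hmem _ (lie_mem_right ℂ G I Z Y hY)
  let Q : LieSubmodule ℂ G M :=
    { carrier := {y | ∀ Y ∈ I, ⁅Y, y⁆ = 0}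
      add_mem' := fun ha hb Y hY => by rw [lie_add, ha Y hY, hb Y hY, add_zero]
      zero_mem' := fun Y _ => lie_zero Y
      smul_mem' := fun r a ha Y hY => by rw [lie_smul, ha Y hY, smul_zero]
      lie_mem := fun {Z m} hm Y hY => by
        rw [leibniz_lie, hm Y hY, lie_zero, add_zero]
        exact hm _ (lie_mem_left ℂ G I Y Z hY) }
  have hQ : Q = ⊤ := hv.gen Q fun Y hY => by
    have := hmem Y hY
    rwa [hS₀, Submodule.mem_bot] at this
  have hx : x ∈ Q := hQ ▸ LieSubmodule.mem_top x
  exact hx X hX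

end IsHighestWeight

end HighestWeight

/-! ### Local nilpotency of the positive part -/

section Nilpotent

variable {G : Type*} [LieRing G] [LieAlgebra ℂ G] (D : G)
variable (M : Type*) [AddCommGroup M] [Module ℂ M] [LieRingModule G M] [LieModule ℂ G M]

/-- The sum of the eigenspaces of `D` on `M` for the eigenvalues `c`, `c - 1`, ..., `c - K + 1`. -/
def upper (c : ℂ) (K : ℕ) : Submodule ℂ M := ⨆ k : Fin K, wt D M (c - (k : ℕ))

variable {D M}

lemma upper_zero (c : ℂ) : upper D M c 0 = ⊥ := by
  simp [upper]

lemma wt_le_upper (c : ℂ) {k K : ℕ} (h : k < K) : wt D M (c - k) ≤ upper D M c K :=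
  le_iSup (fun k : Fin K => wt D M (c - (k : ℕ))) ⟨k, h⟩

lemma upper_mono (c : ℂ) : Monotone (upper D M c) := fun _ _ h =>
  iSup_le fun k => wt_le_upper c (k.2.trans_le h)

variable {chi : G →ₗ[ℂ] ℂ} {v : M}

lemma IsHighestWeight.exists_mem_upper (hv : IsHighestWeight D chi v)
    (htop : negG D ⊔ wt D G 0 ⊔ posG D = ⊤) (x : M) : ∃ K, x ∈ upper D M (chi D) K := by
  suffices (⊤ : Submodule ℂ M) ≤ ⨆ K, upper D M (chi D) K from
    (Submodule.mem_iSup_of_directed _ (upper_mono (chi D)).directed_le).1 (this Submodule.mem_top)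
  rw [← hv.span_sup_lower htop, sup_le_iff, Submodule.span_singleton_le_iff_mem]
  refine ⟨Submodule.mem_iSup_of_mem 1 (wt_le_upper (chi D) zero_lt_one ?_), ?_⟩
  · simpa using hv.mem_wt
  · refine iSup_le fun k => le_iSup_of_le (k + 2) ?_
    have := wt_le_upper (D := D) (M := M) (chi D) (k := k + 1) (K := k + 2) (by omega)
    exact_mod_cast this

/-- Eigenspaces are independent, and those for `chi D - k` with `k` a natural number already exhaust
`M`. -/
lemma IsHighestWeight.wt_eq_bot (hv : IsHighestWeight D chi v)
    (htop : negG D ⊔ wt D G 0 ⊔ posG D = ⊤) (i : ℕ) : wt D M (chi D + (i + 1)) = ⊥ := by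
  have h := disjoint_wt_iSup (D := D) (M := M) (chi D + (i + 1)) (fun k : ℕ => chi D - k)
    fun k h => by
      have : ((k + i : ℕ) : ℂ) + 1 = 0 := by push_cast; linear_combination -h
      exact Nat.cast_add_one_ne_zero _ this
  refine h.eq_bot_of_le fun x _ => ?_
  obtain ⟨K, hK⟩ := hv.exists_mem_upper htop x
  exact (iSup_le fun k => le_iSup (fun k : ℕ => wt D M (chi D - k)) k : upper D M (chi D) K ≤ _) hK

/-- An element of degree `j + 1` moves depth `k` to depth `k - (j + 1)`, or above the top
eigenvalue, where nothing is left. Each application of the positive part thus shortens the range by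
at least one, which drives the induction in `exists_tmul_mem`. -/
lemma IsHighestWeight.pos_lie_upper (hv : IsHighestWeight D chi v)
    (htop : negG D ⊔ wt D G 0 ⊔ posG D = ⊤) {X : G} (hX : X ∈ posG D) {K : ℕ} {x : M}
    (hx : x ∈ upper D M (chi D) (K + 1)) : ⁅X, x⁆ ∈ upper D M (chi D) K := by
  refine lie_mem_of_iSup hX fun j Y hY => ?_
  suffices upper D M (chi D) (K + 1) ≤
    (upper D M (chi D) K).comap (LieModule.toEnd ℂ G M Y) from this hx
  refine iSup_le fun k m hm => ?_
  change ⁅Y, m⁆ ∈ upper D M (chi D) K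
  have h := lie_mem_wt hY hm
  rcases lt_or_ge (k : ℕ) (j + 1) with hk | hk
  · obtain ⟨i, hi⟩ := Nat.exists_eq_add_of_lt hk
    have hi' : (j : ℂ) + 1 = k + i + 1 := by exact_mod_cast hi
    rw [show (j : ℂ) + 1 + (chi D - (k : ℕ)) = chi D + (i + 1) by rw [hi']; ring,
      hv.wt_eq_bot htop, Submodule.mem_bot] at h
    rw [h]; exact zero_mem _
  · obtain ⟨i, hi⟩ := Nat.exists_eq_add_of_le hk
    have hi' : ((k : ℕ) : ℂ) = j + 1 + i := by exact_mod_cast hi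
    rw [hi', show (j : ℂ) + 1 + (chi D - (j + 1 + i)) = chi D - (i : ℕ) by ring] at h
    exact wt_le_upper _ (by omega) h

end Nilpotent

end GradedLie

namespace GradedLie

/-! ### Irreducibility of tensor products -/

section Tensor

variable {G : Type*} [LieRing G] [LieAlgebra ℂ G]
variable {M : Type*} [AddCommGroup M] [Module ℂ M] [LieRingModule G M] [LieModule ℂ G M]
variable {M' : Type*} [AddCommGroup M'] [Module ℂ M'] [LieRingModule G M'] [LieModule ℂ G M']
variable {D : G} {chi chi' : G →ₗ[ℂ] ℂ} {v : M} {v' : M'}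

lemma tmul_ne_zero {x : M} {y : M'} (hx : x ≠ 0) (hy : y ≠ 0) : x ⊗ₜ[ℂ] y ≠ 0 := by
  classical
  intro h
  let e := Module.Basis.ofVectorSpace ℂ M'
  refine hy (e.repr.map_eq_zero_iff.1 (Finsupp.ext fun i => ?_))
  have := congrArg (fun u => TensorProduct.equivFinsuppOfBasisRight (M := M) e u i) h
  rw [TensorProduct.equivFinsuppOfBasisRight_apply_tmul_apply, map_zero] at this
  simpa [hx] using this

omit [LieRingModule G M'] [LieModule ℂ G M'] in
/-- A nonzero subspace of `M ⊗ M'` stable under `posG D` acting on the first factor contains some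
`v ⊗ y ≠ 0`. -/
lemma IsHighestWeight.exists_tmul_mem (hv : IsHighestWeight D chi v)
    (htop : negG D ⊔ wt D G 0 ⊔ posG D = ⊤) (hirr : ∀ S : LieSubmodule ℂ G M, S = ⊥ ∨ S = ⊤)
    {S : Submodule ℂ (M ⊗[ℂ] M')} (hS : S ≠ ⊥)
    (hpos : ∀ X ∈ posG D, ∀ u ∈ S, (LieModule.toEnd ℂ G M X).rTensor M' u ∈ S) :
    ∃ y : M', y ≠ 0 ∧ v ⊗ₜ[ℂ] y ∈ S := by
  classical
  let e := Module.Basis.ofVectorSpace ℂ M'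
  -- A basis of `M'` turns `M ⊗ M'` into finitely supported families in `M`, on which an action on
  -- the first factor is coordinatewise.
  let φ := TensorProduct.equivFinsuppOfBasisRight (M := M) e
  have hφ : ∀ (X : G) u i, φ ((LieModule.toEnd ℂ G M X).rTensor M' u) i = ⁅X, φ u i⁆ := by
    intro X u i
    induction u using TensorProduct.induction_on with
    | zero => simp
    | add x y hx hy => simp only [map_add, Finsupp.add_apply, hx, hy, lie_add]
    | tmul x y => simp [φ]
  obtain ⟨u, hu, hu0⟩ := S.ne_bot_iff.1 hS
  have hK : ∃ K, ∀ i, φ u i ∈ upper D M (chi D) K := by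
    clear hu hu0
    induction u using TensorProduct.induction_on with
    | zero => exact ⟨0, fun i => by simp⟩
    | add x y hx hy =>
      obtain ⟨K, hK⟩ := hx
      obtain ⟨L, hL⟩ := hy
      refine ⟨max K L, fun i => ?_⟩
      rw [map_add, Finsupp.add_apply]
      exact add_mem (upper_mono _ (le_max_left K L) (hK i)) (upper_mono _ (le_max_right K L) (hL i))
    | tmul x y =>
      obtain ⟨K, hK⟩ := hv.exists_mem_upper htop x
      refine ⟨K, fun i => ?_⟩
      rw [TensorProduct.equivFinsuppOfBasisRight_apply_tmul_apply]
      exact Submodule.smul_mem _ _ hK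
  obtain ⟨K, hK⟩ := hK
  -- Induction on a common depth `K` for all coordinates. Either `posG D` kills `u`, and every
  -- coordinate is a multiple of `v`, or some `X` gives a nonzero vector of smaller depth.
  induction K generalizing u with
  | zero =>
    refine absurd (φ.map_eq_zero_iff.1 (Finsupp.ext fun i => ?_)) hu0
    simpa [upper_zero] using hK i
  | succ K ih =>
    by_cases h : ∀ X ∈ posG D, (LieModule.toEnd ℂ G M X).rTensor M' u = 0
    · have hs : ∀ i, ∃ a : ℂ, a • v = φ u i := fun i =>
        Submodule.mem_span_singleton.1 (hv.mem_span_of_pos htop hirr fun X hX => by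
          rw [← hφ, h X hX, map_zero, Finsupp.zero_apply])
      choose a ha using hs
      have hu' : u = v ⊗ₜ[ℂ] ∑ i ∈ (φ u).support, a i • e i := by
        conv_lhs => rw [← φ.symm_apply_apply u]
        rw [TensorProduct.equivFinsuppOfBasisRight_symm_apply, Finsupp.sum, TensorProduct.tmul_sum]
        refine Finset.sum_congr rfl fun i _ => ?_
        rw [← ha, TensorProduct.smul_tmul]
      refine ⟨_, fun h0 => hu0 ?_, hu' ▸ hu⟩
      rw [hu', h0, TensorProduct.tmul_zero]
    · push Not at h
      obtain ⟨X, hX, hXu⟩ := h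
      exact ih _ (hpos X hX u hu) hXu fun i => by
        rw [hφ]; exact hv.pos_lie_upper htop hX (hK i)

/-- The tensor product of two irreducible highest weight modules is irreducible if a subspace of
`G` containing `posG D` and complemented by `D` acts on the two factors independently. -/
lemma tensor_irreducible (hv : IsHighestWeight D chi v)
    (htop : negG D ⊔ wt D G 0 ⊔ posG D = ⊤) (hirr : ∀ S : LieSubmodule ℂ G M, S = ⊥ ∨ S = ⊤)
    (hirr' : ∀ S : LieSubmodule ℂ G M', S = ⊥ ∨ S = ⊤) {A : Submodule ℂ G} (hA : posG D ≤ A)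
    (hD : ∀ X : G, ∃ r : ℂ, X - r • D ∈ A)
    (hsep : ∀ X ∈ A, ∃ Y : G, (∀ x : M, ⁅Y, x⁆ = ⁅X, x⁆) ∧ ∀ y : M', ⁅Y, y⁆ = 0)
    (S : LieSubmodule ℂ G (M ⊗[ℂ] M')) : S = ⊥ ∨ S = ⊤ := by
  rw [or_iff_not_imp_left]
  intro hS
  have hleft : ∀ X ∈ A, ∀ u ∈ S, (LieModule.toEnd ℂ G M X).rTensor M' u ∈ S := by
    intro X hX u hu
    obtain ⟨Y, hY, hY'⟩ := hsep X hX
    suffices key : (LieModule.toEnd ℂ G M X).rTensor M' u = ⁅Y, u⁆ by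
      rw [key]
      exact S.lie_mem hu
    clear hu
    induction u using TensorProduct.induction_on with
    | zero => simp
    | add x y hx hy => rw [map_add, lie_add, hx, hy]
    | tmul x y =>
      rw [TensorProduct.LieModule.lie_tmul_right, hY, hY', TensorProduct.tmul_zero, add_zero]
      rfl
  have hS' : S.toSubmodule ≠ ⊥ := fun h => hS ((LieSubmodule.toSubmodule_eq_bot S).1 h)
  obtain ⟨y₀, hy₀, hy₀S⟩ := hv.exists_tmul_mem htop hirr hS' fun X hX u hu => hleft X (hA hX) u hu
  let Q' : LieSubmodule ℂ G M' :=
    { S.toSubmodule.comap (TensorProduct.mk ℂ M M' v) with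
      lie_mem := fun {X y} hy => by
        change v ⊗ₜ[ℂ] y ∈ S at hy
        change v ⊗ₜ[ℂ] ⁅X, y⁆ ∈ S
        obtain ⟨r, hr⟩ := hD X
        have h1 := S.lie_mem (x := X) hy
        have h2 := hleft _ hr _ hy
        rw [TensorProduct.LieModule.lie_tmul_right] at h1
        rw [LinearMap.rTensor_tmul, LieModule.toEnd_apply_apply, sub_lie, smul_lie,
          hv.zero D self_mem_wt, TensorProduct.sub_tmul, smul_smul, ← TensorProduct.smul_tmul'] at h2
        -- `v ⊗ X y` equals `X (v ⊗ y) - (X - r D) v ⊗ y - r chi(D) v ⊗ y`, because `D v = chi(D)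
        -- v`.
        have h3 := sub_mem (sub_mem h1 h2) (S.smul_mem (r * chi D) hy)
        convert h3 using 1
        abel }
  have hQ' : Q' = ⊤ := (hirr' Q').resolve_left fun h => hy₀ (by
    have : y₀ ∈ Q' := hy₀S
    rwa [h, LieSubmodule.mem_bot] at this)
  let Q : LieSubmodule ℂ G M :=
    { carrier := {x | ∀ y : M', x ⊗ₜ[ℂ] y ∈ S}
      add_mem' := fun ha hb y => by rw [TensorProduct.add_tmul]; exact add_mem (ha y) (hb y)
      zero_mem' := fun y => by rw [TensorProduct.zero_tmul]; exact zero_mem _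
      smul_mem' := fun r a ha y => by rw [← TensorProduct.smul_tmul']; exact S.smul_mem r (ha y)
      lie_mem := fun {X x} hx y => by
        obtain ⟨r, hr⟩ := hD X
        have h1 := S.lie_mem (x := D) (hx y)
        have h2 := hleft _ hr _ (hx y)
        rw [TensorProduct.LieModule.lie_tmul_right] at h1
        rw [LinearMap.rTensor_tmul, LieModule.toEnd_apply_apply, sub_lie, smul_lie,
          TensorProduct.sub_tmul, ← TensorProduct.smul_tmul'] at h2
        -- `X x ⊗ y` equals `(X - r D) x ⊗ y + r (D (x ⊗ y) - x ⊗ D y)`; the last term is in `S`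
        -- since `x` is allowed with every second factor.
        have h3 := add_mem h2 (S.smul_mem r (sub_mem h1 (hx ⁅D, y⁆)))
        convert h3 using 1
        rw [add_sub_cancel_right, sub_add_cancel] }
  have hQ : Q = ⊤ := hv.gen Q fun y => by
    have : y ∈ Q' := hQ' ▸ LieSubmodule.mem_top y
    exact this
  rw [eq_top_iff]
  intro u _
  induction u using TensorProduct.induction_on with
  | zero => exact zero_mem _
  | add x y hx hy => exact add_mem (hx trivial) (hy trivial)
  | tmul x y =>
    have : x ∈ Q := hQ ▸ LieSubmodule.mem_top x
    exact this y

lemma IsHighestWeight.tmul (hv : IsHighestWeight D chi v) (hv' : IsHighestWeight D chi' v')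
    (hirr : ∀ S : LieSubmodule ℂ G (M ⊗[ℂ] M'), S = ⊥ ∨ S = ⊤) :
    IsHighestWeight D (chi + chi') (v ⊗ₜ[ℂ] v') where
  ne_zero := tmul_ne_zero hv.ne_zero hv'.ne_zero
  pos X hX := by
    rw [TensorProduct.LieModule.lie_tmul_right, hv.pos X hX, hv'.pos X hX, TensorProduct.zero_tmul,
      TensorProduct.tmul_zero, add_zero]
  zero X hX := by
    rw [TensorProduct.LieModule.lie_tmul_right, hv.zero X hX, hv'.zero X hX, TensorProduct.tmul_smul,
      ← TensorProduct.smul_tmul', ← add_smul, LinearMap.add_apply]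
  gen S hS := (hirr S).resolve_left fun h => by
    rw [h, LieSubmodule.mem_bot] at hS
    exact tmul_ne_zero hv.ne_zero hv'.ne_zero hS

end Tensor

end GradedLie

namespace GradedLie

/-! ### Nonvanishing of modules induced from a character -/

section Induced

attribute [local instance] LieRing.ofAssociativeRing

open UniversalEnvelopingAlgebra

variable {L : Type*} [LieRing L] [LieAlgebra ℂ L]

/-- A subspace stable under left multiplication by `L` is a left ideal of the enveloping algebra. -/
lemma mul_mem_of_ι_mul_mem {M : Type*} [AddCommGroup M] [Module ℂ M]
    [Module (UniversalEnvelopingAlgebra ℂ L) M] [IsScalarTower ℂ (UniversalEnvelopingAlgebra ℂ L) M]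
    {S : Submodule ℂ M} (h : ∀ x : L, ∀ w ∈ S, ι ℂ x • w ∈ S)
    (u : UniversalEnvelopingAlgebra ℂ L) {w : M} (hw : w ∈ S) : u • w ∈ S := by
  let T : Subalgebra ℂ (UniversalEnvelopingAlgebra ℂ L) :=
    { carrier := {u | ∀ w ∈ S, u • w ∈ S}
      mul_mem' := fun ha hb w hw => by rw [mul_smul]; exact ha _ (hb w hw)
      add_mem' := fun ha hb w hw => by rw [add_smul]; exact add_mem (ha w hw) (hb w hw)
      algebraMap_mem' := fun r w hw => by rw [algebraMap_smul]; exact S.smul_mem r hw }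
  let f : L →ₗ⁅ℂ⁆ T :=
    { toFun := fun x => ⟨ι ℂ x, h x⟩
      map_add' := fun x y => Subtype.ext (map_add (ι ℂ) x y)
      map_smul' := fun r x => Subtype.ext (map_smul (ι ℂ) r x)
      map_lie' := fun {x y} => Subtype.ext (LieHom.map_lie (ι ℂ) x y) }
  -- The elements preserving `S` form a subalgebra containing the generators; by the universal
  -- property it is everything.
  have hf : T.val.comp (lift ℂ f) = AlgHom.id ℂ _ := by
    ext x
    change ((lift ℂ f (ι ℂ x) : T) : UniversalEnvelopingAlgebra ℂ L) = ι ℂ x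
    rw [lift_ι_apply]
    rfl
  have hu : ((lift ℂ f u : T) : UniversalEnvelopingAlgebra ℂ L) = u := DFunLike.congr_fun hf u
  rw [← hu]
  exact (lift ℂ f u).2 w hw

variable {G : Type*} [LieRing G] [LieAlgebra ℂ G] (n : LieSubalgebra ℂ G)

/-- The action of a subalgebra `n` on the linear maps from `G` to the enveloping algebra of `n`. -/
def homAction : n →ₗ⁅ℂ⁆ Module.End ℂ (G →ₗ[ℂ] UniversalEnvelopingAlgebra ℂ n) where
  toFun x :=
    { toFun := fun φ => (LinearMap.mulLeft ℂ (ι ℂ x)) ∘ₗ φ - φ ∘ₗ LieAlgebra.ad ℂ G (x : G)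
      map_add' := fun φ ψ => by ext y; simp [-ι_apply, mul_add]; abel
      map_smul' := fun r φ => by ext y; simp [-ι_apply, smul_sub] }
  map_add' x y := by ext φ z; simp [-ι_apply, add_mul]; abel
  map_smul' r x := by ext φ z; simp [-ι_apply, smul_sub]
  map_lie' {x y} := by
    ext φ z
    simp [-ι_apply, LieRing.of_associative_ring_bracket, sub_mul, mul_sub, mul_assoc]
    abel

lemma homAction_apply (x : n) (φ : G →ₗ[ℂ] UniversalEnvelopingAlgebra ℂ n) (y : G) :
    homAction n x φ y = ι ℂ x * φ y - φ ⁅(x : G), y⁆ := rfl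

variable {n}
variable (φ₁ : G →ₗ[ℂ] UniversalEnvelopingAlgebra ℂ n)

/-- The operator on the enveloping algebra of `n` that an element of `G` induces, given its value
at `1`. -/
def inducedOp : G →ₗ[ℂ] Module.End ℂ (UniversalEnvelopingAlgebra ℂ n) :=
  LinearMap.flip
    ((LinearMap.applyₗ φ₁ : Module.End ℂ (G →ₗ[ℂ] UniversalEnvelopingAlgebra ℂ n) →ₗ[ℂ] (G →ₗ[ℂ] UniversalEnvelopingAlgebra ℂ n)) ∘ₗ
      (lift ℂ (homAction n)).toLinearMap)

lemma inducedOp_one (x : G) : inducedOp φ₁ x 1 = φ₁ x := by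
  simp [inducedOp]

/-- The relation `x y w = y x w - [y, x] w` that any `G`-module imposes. It holds by construction:
the map `x ↦ x w` is `w` applied to `φ₁` under `homAction`, so no ordered monomials are needed. -/
lemma inducedOp_ι_mul (x : G) (y : n) (w : UniversalEnvelopingAlgebra ℂ n) :
    inducedOp φ₁ x (ι ℂ y * w) = ι ℂ y * inducedOp φ₁ x w - inducedOp φ₁ ⁅(y : G), x⁆ w := by
  change (lift ℂ (homAction n) (ι ℂ y * w)) φ₁ x = _
  rw [map_mul, lift_ι_apply, Module.End.mul_apply, homAction_apply]
  rfl

lemma uea_induction {P : UniversalEnvelopingAlgebra ℂ n → Prop} (w : UniversalEnvelopingAlgebra ℂ n) (add : ∀ a b, P a → P b → P (a + b))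
    (smul : ∀ (r : ℂ) a, P a → P (r • a)) (one : P 1) (mul : ∀ (x : n) w, P w → P (ι ℂ x * w)) :
    P w := by
  let S : Submodule ℂ (UniversalEnvelopingAlgebra ℂ n) :=
    { carrier := {w | P w}
      add_mem' := fun ha hb => add _ _ ha hb
      zero_mem' := by simpa using smul 0 1 one
      smul_mem' := fun r a ha => smul r a ha }
  have := mul_mem_of_ι_mul_mem (S := S) (fun x w hw => mul x w hw) w one
  rwa [smul_eq_mul, mul_one] at this

variable {φ₁} {b : Submodule ℂ G} {chi : G →ₗ[ℂ] ℂ} (htop : n.toSubmodule ⊔ b = ⊤)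
  (hb : ∀ x ∈ b, ∀ y ∈ b, ⁅x, y⁆ ∈ b) (hchi : ∀ x ∈ b, ∀ y ∈ b, chi ⁅x, y⁆ = 0)
  (hφn : ∀ x : n, φ₁ x = ι ℂ x) (hφb : ∀ x ∈ b, φ₁ x = algebraMap ℂ (UniversalEnvelopingAlgebra ℂ n) (chi x))

include hφn in
lemma inducedOp_coe (x : n) (w : UniversalEnvelopingAlgebra ℂ n) : inducedOp φ₁ x w = ι ℂ x * w := by
  induction w using uea_induction generalizing x with
  | add a b ha hb => rw [map_add, ha, hb, mul_add]
  | smul r a ha => rw [map_smul, ha, mul_smul_comm]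
  | one => rw [inducedOp_one, hφn, mul_one]
  | mul y w hw =>
    rw [inducedOp_ι_mul, hw, ← LieSubalgebra.coe_bracket, hw, LieHom.map_lie,
      LieRing.of_associative_ring_bracket, sub_mul, mul_assoc, mul_assoc]
    abel

include hφn htop hb hchi hφb in
-- The Jacobi identity carries the relation from `w` to `z w`, so only `w = 1` matters. There,
-- splitting along `n` and `b`, brackets with an element of `n` are covered by the defining
-- recursion, and on `b` both sides vanish because scalars commute and `chi` kills brackets.
lemma inducedOp_lie (x y : G) (w : UniversalEnvelopingAlgebra ℂ n) :
    inducedOp φ₁ ⁅x, y⁆ w =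
      inducedOp φ₁ x (inducedOp φ₁ y w) - inducedOp φ₁ y (inducedOp φ₁ x w) := by
  induction w using uea_induction generalizing x y with
  | add a b ha hb => simp only [map_add, ha, hb]; abel
  | smul r a ha => simp only [map_smul, ha, smul_sub]
  | mul z w hw =>
    rw [inducedOp_ι_mul, leibniz_lie (z : G) x y, map_add, LinearMap.add_apply, hw x y,
      hw ⁅(z : G), x⁆ y, hw x ⁅(z : G), y⁆]
    simp only [inducedOp_ι_mul, map_sub, mul_sub]
    abel
  | one =>
    have hx : x ∈ n.toSubmodule ⊔ b := htop ▸ Submodule.mem_top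
    have hy : y ∈ n.toSubmodule ⊔ b := htop ▸ Submodule.mem_top
    obtain ⟨x₁, hx₁, x₂, hx₂, rfl⟩ := Submodule.mem_sup.1 hx
    obtain ⟨y₁, hy₁, y₂, hy₂, rfl⟩ := Submodule.mem_sup.1 hy
    have hn : ∀ (a : n) (c : G), inducedOp φ₁ ⁅(a : G), c⁆ 1 =
        inducedOp φ₁ a (inducedOp φ₁ c 1) - inducedOp φ₁ c (inducedOp φ₁ a 1) := by
      intro a c
      rw [inducedOp_coe hφn, inducedOp_coe hφn, inducedOp_ι_mul]
      abel
    have h₁ := hn ⟨x₁, hx₁⟩ (y₁ + y₂)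
    have h₂ := hn ⟨y₁, hy₁⟩ x₂
    have h₃ : inducedOp φ₁ ⁅x₂, y₂⁆ 1 =
        inducedOp φ₁ x₂ (inducedOp φ₁ y₂ 1) - inducedOp φ₁ y₂ (inducedOp φ₁ x₂ 1) := by
      simp only [inducedOp_one]
      have hφ₁ : ∀ x ∈ b, φ₁ x = chi x • 1 := fun x hx => by
        rw [hφb x hx, Algebra.algebraMap_eq_smul_one]
      rw [hφ₁ _ (hb _ hx₂ _ hy₂), hφ₁ _ hx₂, hφ₁ _ hy₂, hchi _ hx₂ _ hy₂, map_smul, map_smul,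
        inducedOp_one, inducedOp_one, hφ₁ _ hx₂, hφ₁ _ hy₂, smul_comm, sub_self, zero_smul]
    rw [add_lie, lie_add x₂, map_add, map_add, LinearMap.add_apply, LinearMap.add_apply, h₁, h₃,
      ← lie_skew x₂ y₁, map_neg, LinearMap.neg_apply, h₂]
    simp only [map_add, LinearMap.add_apply]
    abel

/-- The module induced from a character of a subalgebra with a complementary subalgebra is
nonzero. -/
theorem one_notMem_span (hcompl : IsCompl n.toSubmodule b)
    (hb : ∀ x ∈ b, ∀ y ∈ b, ⁅x, y⁆ ∈ b) (hchi : ∀ x ∈ b, ∀ y ∈ b, chi ⁅x, y⁆ = 0) :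
    (1 : UniversalEnvelopingAlgebra ℂ G) ∉
      Submodule.span (UniversalEnvelopingAlgebra ℂ G)
        {u | ∃ x ∈ b, u = ι ℂ x - algebraMap ℂ (UniversalEnvelopingAlgebra ℂ G) (chi x)} := by
  let φ₁ : G →ₗ[ℂ] UniversalEnvelopingAlgebra ℂ n := LinearMap.ofIsCompl hcompl
    (ι ℂ : n →ₗ⁅ℂ⁆ UniversalEnvelopingAlgebra ℂ n).toLinearMap ((Algebra.linearMap ℂ (UniversalEnvelopingAlgebra ℂ n) ∘ₗ chi) ∘ₗ b.subtype)
  have hφn : ∀ x : n, φ₁ x = ι ℂ x := fun x => LinearMap.ofIsCompl_apply_left hcompl x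
  have hφb : ∀ x ∈ b, φ₁ x = algebraMap ℂ (UniversalEnvelopingAlgebra ℂ n) (chi x) := fun x hx =>
    LinearMap.ofIsCompl_apply_right hcompl ⟨x, hx⟩
  let σ : G →ₗ⁅ℂ⁆ Module.End ℂ (UniversalEnvelopingAlgebra ℂ n) :=
    { inducedOp φ₁ with
      map_lie' := fun {x y} => by
        ext w
        exact inducedOp_lie hcompl.sup_eq_top hb hchi hφn hφb x y w }
  intro h
  have hker : ∀ u ∈ Submodule.span (UniversalEnvelopingAlgebra ℂ G)
      {u | ∃ x ∈ b, u = ι ℂ x - algebraMap ℂ (UniversalEnvelopingAlgebra ℂ G) (chi x)},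
      lift ℂ σ u 1 = 0 := by
    intro u hu
    induction hu using Submodule.span_induction with
    | mem u hu =>
      obtain ⟨x, hx, rfl⟩ := hu
      rw [map_sub, lift_ι_apply, AlgHom.commutes, LinearMap.sub_apply, Module.algebraMap_end_apply]
      change inducedOp φ₁ x 1 - _ = 0
      rw [inducedOp_one, hφb x hx, Algebra.algebraMap_eq_smul_one, sub_self]
    | zero => simp
    | add u w _ _ hu hw => rw [map_add, LinearMap.add_apply, hu, hw, add_zero]
    | smul a u _ hu => rw [smul_eq_mul, map_mul, Module.End.mul_apply, hu, map_zero]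
  have h1 := hker 1 h
  rw [map_one (lift ℂ σ), Module.End.one_apply] at h1
  -- The augmentation of the enveloping algebra of `n` shows `1 ≠ 0` there.
  have h2 := congrArg (lift ℂ (0 : n →ₗ⁅ℂ⁆ ℂ)) h1
  rw [map_one, map_zero] at h2
  exact one_ne_zero h2

end Induced

end GradedLie

noncomputable section

namespace DoubleAffine

open GradedLie

/-! ### Monomials and degrees in the toroidal algebra -/

section Algebra

variable {g : Type*} [LieRing g] [LieAlgebra ℂ g] (B : InvariantForm g)

/-- The bilinear map `(x, a) ↦ x ⊗ a`. -/
def eltHom : g →ₗ[ℂ] Laurent₂ →ₗ[ℂ] Toroidal B :=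
  LinearMap.mk₂ ℂ (elt B)
    (fun x y a => by
      ext
      · exact TensorProduct.tmul_add a x y
      all_goals simp [elt])
    (fun r x a => by
      ext
      · exact TensorProduct.tmul_smul r a x
      all_goals simp [elt])
    (fun x a c => by
      ext
      · exact TensorProduct.add_tmul a c x
      all_goals simp [elt])
    (fun r x a => by
      ext
      · exact TensorProduct.smul_tmul' r a x
      all_goals simp [elt])

lemma eltHom_apply (x : g) (a : Laurent₂) : eltHom B x a = elt B x a := rfl

lemma inclT₂_T (n : ℤ) : inclT₂ (LaurentPolynomial.T n) = mono 0 n := by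
  rw [inclT₂, LaurentPolynomial.T, AddMonoidAlgebra.mapDomainAlgHom_apply,
    AddMonoidAlgebra.mapDomain_single]
  rfl

lemma mono_mul_mono (m n m' n' : ℤ) : mono m n * mono m' n' = mono (m + m') (n + n') := by
  simp [mono, AddMonoidAlgebra.single_mul_single]

lemma mono_mul_inclT₂_T (m n : ℤ) : mono m 0 * inclT₂ (LaurentPolynomial.T n) = mono m n := by
  rw [inclT₂_T, mono_mul_mono, add_zero, zero_add]

lemma mono_zero_zero : mono 0 0 = 1 := rfl

variable {B} in
lemma elt_mul_inclT₂_mem {S : Submodule ℂ (Toroidal B)} {x : g} {m : ℤ}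
    (h : ∀ n, elt B x (mono m n) ∈ S) (f : ℂ[T;T⁻¹]) : elt B x (mono m 0 * inclT₂ f) ∈ S := by
  induction f using LaurentPolynomial.induction_on' with
  | add p q hp hq =>
    rw [map_add, mul_add, ← eltHom_apply, map_add]
    exact add_mem hp hq
  | C_mul_T n a =>
    rw [← LaurentPolynomial.smul_eq_C_mul, map_smul, mul_smul_comm, mono_mul_inclT₂_T,
      ← eltHom_apply, map_smul]
    exact S.smul_mem a (h n)

lemma span_mono : Submodule.span ℂ (Set.range fun m : ℤ × ℤ => mono m.1 m.2) = ⊤ := by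
  rw [eq_top_iff]
  intro a _
  induction a using AddMonoidAlgebra.induction_linear with
  | zero => exact zero_mem _
  | add x y hx hy => exact add_mem (hx trivial) (hy trivial)
  | single m r =>
    rw [show AddMonoidAlgebra.single m r = r • mono m.1 m.2 by
      simp [mono, AddMonoidAlgebra.smul_single]]
    exact Submodule.smul_mem _ _ (Submodule.subset_span ⟨m, rfl⟩)

lemma loop_elt_mem {S : Submodule ℂ (Toroidal B)} (h : ∀ x m n, elt B x (mono m n) ∈ S)
    (u : Loop₂ g) : Toroidal.mk u 0 0 0 ∈ S := by
  induction u using loop_induction with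
  | zero => exact zero_mem _
  | add u v hu hv =>
    convert add_mem hu hv using 1
    ext <;> simp
  | tens a x =>
    have ha : a ∈ Submodule.span ℂ (Set.range fun m : ℤ × ℤ => mono m.1 m.2) :=
      span_mono ▸ Submodule.mem_top
    have : Submodule.span ℂ (Set.range fun m : ℤ × ℤ => mono m.1 m.2) ≤ S.comap (eltHom B x) := by
      rw [Submodule.span_le]
      rintro _ ⟨m, rfl⟩
      exact h x m.1 m.2
    exact this ha

lemma toroidal_eq (X : Toroidal B) : X = Toroidal.mk X.loop 0 0 0 + X.coeffC₁ • c₁ B +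
    X.coeffC₂ • c₂ B + X.coeffD₁ • d₁ B := by
  ext <;> simp [c₁, c₂, d₁]

lemma lie_c₁ (X : Toroidal B) : ⁅X, c₁ B⁆ = 0 := by rw [← lie_skew, c₁_lie, neg_zero]

lemma lie_c₂ (X : Toroidal B) : ⁅X, c₂ B⁆ = 0 := by rw [← lie_skew, c₂_lie, neg_zero]

/-- The element `K d₁ + ρ`. -/
def grader (K : ℤ) (ρ : g) : Toroidal B := (K : ℂ) • d₁ B + elt B ρ (mono 0 0)

variable {B}

lemma grader_lie_elt (K : ℤ) (ρ : g) {x : g} {r : ℂ} (hx : ⁅ρ, x⁆ = r • x) (m n : ℤ) :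
    ⁅grader B K ρ, elt B x (mono m n)⁆ = ((K : ℂ) * m + r) • elt B x (mono m n) := by
  rw [grader, add_lie, smul_lie, d₁_lie_elt, elt_lie_elt, hx]
  simp only [zero_add, Int.cast_zero, zero_smul, add_zero, smul_zero]
  rw [← eltHom_apply, ← eltHom_apply, map_smul, LinearMap.smul_apply, smul_smul, add_smul]

lemma elt_mem_wt (K : ℤ) (ρ : g) {x : g} {r : ℤ} (hx : ⁅ρ, x⁆ = (r : ℂ) • x) (m n : ℤ) :
    elt B x (mono m n) ∈ wt (grader B K ρ) (Toroidal B) ((K * m + r : ℤ) : ℂ) := by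
  rw [mem_wt, grader_lie_elt K ρ hx]
  push_cast
  rfl

lemma mem_posG_of_wt {G : Type*} [LieRing G] [LieAlgebra ℂ G] {D X : G} {k : ℤ}
    (hX : X ∈ wt D G (k : ℂ)) (hk : 0 < k) : X ∈ posG D := by
  obtain ⟨j, rfl⟩ := Int.eq_succ_of_zero_lt hk
  refine le_iSup (fun j : ℕ => wt D G ((j : ℂ) + 1)) j ?_
  simpa using hX

lemma mem_negG_of_wt {G : Type*} [LieRing G] [LieAlgebra ℂ G] {D X : G} {k : ℤ}
    (hX : X ∈ wt D G (k : ℂ)) (hk : k < 0) : X ∈ negG D := by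
  obtain ⟨j, hj⟩ := Int.eq_succ_of_zero_lt (neg_pos.2 hk)
  obtain rfl : k = -(j + 1 : ℤ) := by rw [← neg_neg k, hj]
  refine le_iSup (fun j : ℕ => wt D G (-((j : ℂ) + 1))) j ?_
  simpa only [Int.cast_neg, Int.cast_add, Int.cast_natCast, Int.cast_one] using hX

variable {K : ℤ} {ρ : g}

lemma c₁_mem_wt : c₁ B ∈ wt (grader B K ρ) (Toroidal B) 0 := by
  rw [mem_wt, lie_c₁, zero_smul]

lemma c₂_mem_wt : c₂ B ∈ wt (grader B K ρ) (Toroidal B) 0 := by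
  rw [mem_wt, lie_c₂, zero_smul]

lemma d₁_mem_wt : d₁ B ∈ wt (grader B K ρ) (Toroidal B) 0 := by
  rw [mem_wt, grader, add_lie, smul_lie, lie_self, ← lie_skew, d₁_lie_elt]
  simp

end Algebra

/-! ### The grading by `K d₁ + ρ` -/

section Grading

open LieAlgebra LieAlgebra.IsKilling

variable {g : Type*} [LieRing g] [LieAlgebra ℂ g] (B : InvariantForm g) {H : LieSubalgebra ℂ g}
variable [FiniteDimensional ℂ g] [IsKilling ℂ g] [H.IsCartanSubalgebra]
  (b : (rootSystem H).Base)

/-- The element of the Cartan subalgebra on which each root takes its height as value. -/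
lemma exists_height_vector :
    ∃ ρ : H, ∀ α : H.root, (α : LieModule.Weight ℂ H g) ρ = (b.height α : ℂ) := by
  -- The functional equal to `1` on all simple roots; by reflexivity it is evaluation at a vector of
  -- `H`.
  let φ : Module.Dual ℂ (Module.Dual ℂ H) := b.toWeightBasis.constr ℂ fun _ => (1 : ℂ)
  refine ⟨(Module.evalEquiv ℂ H).symm φ, fun α => ?_⟩
  have h : ∀ ψ : Module.Dual ℂ H, ψ ((Module.evalEquiv ℂ H).symm φ) = φ ψ := fun ψ => by
    conv_rhs => rw [← (Module.evalEquiv ℂ H).apply_symm_apply φ]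
    rw [Module.evalEquiv_apply, Module.Dual.eval_apply]
  obtain ⟨f, -, -, hf⟩ := b.exists_root_eq_sum_int α
  rw [RootPairing.Base.height_eq_sum hf]
  have h' := h ((rootSystem H).root α)
  rw [rootSystem_root_apply, LieModule.Weight.toLinear_apply] at h'
  rw [h']
  have hα : (α : LieModule.Weight ℂ H g).toLinear = (rootSystem H).root α := rfl
  rw [hα, hf, map_sum, Int.cast_sum]
  refine Finset.sum_congr rfl fun j hj => ?_
  have : φ ((rootSystem H).root j) = 1 := by
    rw [← b.toWeightBasis_apply ⟨j, hj⟩, Module.Basis.constr_basis]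
  rw [map_zsmul, this, zsmul_eq_mul, mul_one]

/-- Such a `K` lets the degree in `t₁` dominate: `K m + ht α` has the sign of `m` as soon as `m ≠
0`. -/
lemma exists_height_bound : ∃ K : ℤ, 0 < K ∧ ∀ α : H.root, |b.height α| < K := by
  have hne : 0 ≤ ∑ α : H.root, |b.height α| := Finset.sum_nonneg fun _ _ => abs_nonneg _
  refine ⟨∑ α : H.root, |b.height α| + 1, by omega, fun α => ?_⟩
  have := Finset.single_le_sum (f := fun α : H.root => |b.height α|) (fun _ _ => abs_nonneg _)
    (Finset.mem_univ α)
  exact Int.lt_add_one_of_le this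

variable {B} {K : ℤ} {ρ : H} (hρ : ∀ α : H.root, (α : LieModule.Weight ℂ H g) ρ = (b.height α : ℂ))
  (hK₀ : 0 < K) (hK : ∀ α : H.root, |b.height α| < K)

include hρ in
lemma height_lie (α : H.root) {x : g} (hx : x ∈ rootSpace H (α : LieModule.Weight ℂ H g)) :
    ⁅(ρ : g), x⁆ = (b.height α : ℂ) • x := by
  rw [← hρ]
  exact lie_eq_smul_of_mem_rootSpace hx ρ

lemma cartan_lie (h h' : H) : ⁅(h : g), (h' : g)⁆ = 0 := by
  rw [← LieSubalgebra.coe_bracket, trivial_lie_zero, ZeroMemClass.coe_zero]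

lemma cartan_mem_wt (h : H) (n : ℤ) :
    elt B (h : g) (mono 0 n) ∈ wt (grader B K (ρ : g)) (Toroidal B) 0 := by
  have := elt_mem_wt (B := B) K (ρ : g) (x := (h : g)) (r := 0) (by rw [cartan_lie]; simp) 0 n
  simpa using this

lemma zeroPart_le_wt : zeroPart B H ≤ wt (grader B K ρ) (Toroidal B) 0 := by
  rw [zeroPart, Submodule.span_le]
  rintro _ (⟨h, hh, f, rfl⟩ | hX)
  · have := elt_mul_inclT₂_mem (fun n => cartan_mem_wt (B := B) (K := K) (ρ := ρ) ⟨h, hh⟩ n) f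
    rwa [mono_zero_zero, one_mul] at this
  · rcases hX with rfl | rfl | rfl
    exacts [c₁_mem_wt, c₂_mem_wt, d₁_mem_wt]

omit [IsKilling ℂ g] in
/-- A decomposition of `g` into the Cartan subalgebra and root spaces. -/
lemma root_induction {S : Submodule ℂ g} (hH : ∀ h : H, (h : g) ∈ S)
    (hα : ∀ (α : H.root) (x : g), x ∈ rootSpace H (α : LieModule.Weight ℂ H g) → x ∈ S) (x : g) :
    x ∈ S := by
  have htop := congrArg LieSubmodule.toSubmodule (cartan_sup_iSup_rootSpace_eq_top (K := ℂ) (H := H))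
  simp only [LieSubmodule.sup_toSubmodule, LieSubmodule.iSup_toSubmodule,
    LieSubmodule.top_toSubmodule] at htop
  have hx : x ∈ (⊤ : Submodule ℂ g) := Submodule.mem_top
  rw [← htop] at hx
  refine (sup_le (fun y hy => hH ⟨y, hy⟩) (iSup₂_le fun α hα' y hy => ?_) : _ ≤ S) hx
  exact hα ⟨α, by simpa using hα'⟩ y hy

include hρ hK₀ hK

/-- The eigenvalue `K m + ht α` is never zero and does not involve `n`. The quantifier over `n`
therefore sits inside each alternative, so that `t₂^n` can later be replaced by any Laurent
polynomial in `t₂`. -/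
lemma elt_mem_negG_or (α : H.root) {x : g} (hx : x ∈ rootSpace H (α : LieModule.Weight ℂ H g))
    (m : ℤ) : (∀ n, elt B x (mono m n) ∈ negG (grader B K ρ)) ∨
      (∀ n, elt B x (mono m n) ∈ posPart B b) := by
  have hα := abs_lt.1 (hK α)
  have h0 := b.height_ne_zero α
  rcases lt_trichotomy m 0 with hm | rfl | hm
  · exact Or.inl fun n => mem_negG_of_wt (elt_mem_wt K (ρ : g) (height_lie b hρ α hx) m n) (by nlinarith)
  · rcases lt_or_gt_of_ne h0 with h | h
    · exact Or.inl fun n => mem_negG_of_wt (elt_mem_wt K (ρ : g) (height_lie b hρ α hx) 0 n) (by omega)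
    · exact Or.inr fun n => Submodule.subset_span (Or.inr ⟨α, x, n, h, hx, rfl⟩)
  · exact Or.inr fun n => Submodule.subset_span (Or.inl ⟨x, m, n, hm, rfl⟩)

omit hρ hK in
lemma cartan_mem_negG_or (h : H) {m : ℤ} (hm : m ≠ 0) :
    (∀ n, elt B (h : g) (mono m n) ∈ negG (grader B K ρ)) ∨
      (∀ n, elt B (h : g) (mono m n) ∈ posPart B b) := by
  rcases lt_or_gt_of_ne hm with hm | hm
  · exact Or.inl fun n => mem_negG_of_wt (elt_mem_wt K (ρ : g) (r := 0) (by simp [cartan_lie]) m n) (by nlinarith)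
  · exact Or.inr fun n => Submodule.subset_span (Or.inl ⟨h, m, n, hm, rfl⟩)

lemma posPart_le_posG : posPart B b ≤ posG (grader B K ρ) := by
  rw [posPart, Submodule.span_le]
  rintro _ (⟨x, m, n, hm, rfl⟩ | ⟨α, x, n, hα, hx, rfl⟩)
  · refine root_induction (H := H) (S := (posG (grader B K ρ)).comap ((eltHom B).flip (mono m n)))
      (fun h => ?_) (fun α x hx => ?_) x
    · exact mem_posG_of_wt (elt_mem_wt K (ρ : g) (r := 0) (by simp [cartan_lie]) m n) (by nlinarith)
    · have := abs_lt.1 (hK α)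
      exact mem_posG_of_wt (elt_mem_wt K (ρ : g) (height_lie b hρ α hx) m n) (by nlinarith)
  · have : 0 < b.height α := hα
    exact mem_posG_of_wt (elt_mem_wt K (ρ : g) (height_lie b hρ α hx) 0 n) (by omega)

lemma negG_sup_zeroPart_sup_posPart :
    negG (grader B K ρ) ⊔ zeroPart B H ⊔ posPart B b = ⊤ := by
  rw [eq_top_iff]
  intro X _
  have hz : zeroPart B H ≤ negG (grader B K ρ) ⊔ zeroPart B H ⊔ posPart B b :=
    le_sup_of_le_left le_sup_right
  have hor : ∀ {x m}, ((∀ n, elt B x (mono m n) ∈ negG (grader B K ρ)) ∨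
      (∀ n, elt B x (mono m n) ∈ posPart B b)) → ∀ n, elt B x (mono m n) ∈
      negG (grader B K ρ) ⊔ zeroPart B H ⊔ posPart B b := fun h n =>
    h.elim (fun h => Submodule.mem_sup_left (Submodule.mem_sup_left (h n)))
      (fun h => Submodule.mem_sup_right (h n))
  rw [toroidal_eq B X]
  refine add_mem (add_mem (add_mem (loop_elt_mem B (fun x m n => ?_) _) ?_) ?_) ?_
  · refine root_induction (H := H) (S := (negG (grader B K ρ) ⊔ zeroPart B H ⊔ posPart B b).comap
      ((eltHom B).flip (mono m n))) (fun h => ?_) (fun α x hx => ?_) x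
    · by_cases hm : m = 0
      · subst hm
        exact hz (Submodule.subset_span (Or.inl ⟨h, h.2, _, by rw [inclT₂_T]; rfl⟩))
      · exact hor (cartan_mem_negG_or b hK₀ h hm) n
    · exact hor (elt_mem_negG_or b hρ hK₀ hK α hx m) n
  all_goals exact Submodule.smul_mem _ _ (hz (Submodule.subset_span (Or.inr (by simp))))

end Grading

end DoubleAffine

end

noncomputable section

namespace GradedLie

/-! ### Triangular decomposition and characters of its nonnegative part -/

section Decomposition

variable {G : Type*} [LieRing G] [LieAlgebra ℂ G] {D : G}

lemma disjoint_iSup_wt {ι κ : Type*} (f : ι → ℂ) (h : κ → ℂ) (hne : ∀ i j, f i ≠ h j) :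
    Disjoint (⨆ i, wt D G (f i)) (⨆ j, wt D G (h j)) := by
  have := (LieModule.toEnd ℂ G G D).eigenspaces_iSupIndep.disjoint_biSup_biSup
    (s := Set.range f) (t := Set.range h)
    (by rw [Set.disjoint_left]; rintro _ ⟨i, rfl⟩ ⟨j, hj⟩; exact hne i j hj.symm)
  rwa [iSup_range, iSup_range] at this

lemma disjoint_negG : Disjoint (negG D) (wt D G 0 ⊔ posG D) := by
  refine (disjoint_iSup_wt (fun j : ℕ => -((j : ℂ) + 1)) (fun k : ℕ => (k : ℂ)) ?_).mono_right ?_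
  · intro i j h
    have : ((i + j : ℕ) : ℂ) + 1 = 0 := by push_cast; linear_combination -h
    exact Nat.cast_add_one_ne_zero _ this
  · refine sup_le ?_ (iSup_le fun j => ?_)
    · simpa using le_iSup (fun k : ℕ => wt D G (k : ℂ)) 0
    · simpa using le_iSup (fun k : ℕ => wt D G (k : ℂ)) (j + 1)

lemma disjoint_wt_posG : Disjoint (wt D G 0) (posG D) :=
  disjoint_wt_iSup 0 _ fun j h => Nat.cast_add_one_ne_zero j h

/-- Subspaces of the three parts of the grading that together span `G` are the whole parts. -/
lemma eq_of_sup_eq_top {Z P : Submodule ℂ G} (hZ : Z ≤ wt D G 0) (hP : P ≤ posG D)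
    (htop : negG D ⊔ Z ⊔ P = ⊤) : Z = wt D G 0 ∧ P = posG D := by
  -- Decompose `z₀ + p₀` along `negG D`, `Z`, `P` and compare components, using independence of the
  -- three parts.
  have key : ∀ z₀ ∈ wt D G 0, ∀ p₀ ∈ posG D, z₀ ∈ Z ∧ p₀ ∈ P := by
    intro z₀ hz₀ p₀ hp₀
    have hX : z₀ + p₀ ∈ negG D ⊔ Z ⊔ P := htop ▸ Submodule.mem_top
    obtain ⟨Y, hY, p, hp, h⟩ := Submodule.mem_sup.1 hX
    obtain ⟨n, hn, z, hz, rfl⟩ := Submodule.mem_sup.1 hY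
    have hn0 : n = 0 := by
      refine Submodule.disjoint_def.1 disjoint_negG n hn ?_
      rw [show n = (z₀ - z) + (p₀ - p) by rw [sub_add_sub_comm, ← h]; abel]
      exact Submodule.add_mem_sup (sub_mem hz₀ (hZ hz)) (sub_mem hp₀ (hP hp))
    have hzz : z₀ - z = 0 := by
      refine Submodule.disjoint_def.1 disjoint_wt_posG _ (sub_mem hz₀ (hZ hz)) ?_
      rw [show z₀ - z = p - p₀ from
        sub_eq_sub_iff_add_eq_add.2 (by rw [← h, hn0, zero_add, add_comm])]
      exact sub_mem (hP hp) hp₀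
    obtain rfl := sub_eq_zero.1 hzz
    rw [hn0, zero_add, add_right_inj] at h
    exact ⟨hz, h ▸ hp⟩
  exact ⟨le_antisymm hZ fun z hz => (key z hz 0 (zero_mem _)).1,
    le_antisymm hP fun p hp => (key 0 (zero_mem _) p hp).2⟩

variable (D) in
/-- The sum of the eigenspaces of `ad D` for the negative integers, as a subalgebra. -/
def negSubalgebra : LieSubalgebra ℂ G :=
  { negG D with lie_mem' := fun hx hy => negG_lie_negG hx hy }

/-- A functional on the centralizer of `D` that vanishes on its derived algebra generates a proper
left ideal together with the positive part of `G`. -/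
theorem one_notMem_span_of_grading (htop : negG D ⊔ wt D G 0 ⊔ posG D = ⊤) {chi : G →ₗ[ℂ] ℂ}
    (hpos : ∀ X ∈ posG D, chi X = 0) (hzero : ∀ X ∈ wt D G 0, ∀ Y ∈ wt D G 0, chi ⁅X, Y⁆ = 0) :
    (1 : UniversalEnvelopingAlgebra ℂ G) ∉ Submodule.span (UniversalEnvelopingAlgebra ℂ G)
      {u | ∃ x ∈ wt D G 0 ⊔ posG D, u = UniversalEnvelopingAlgebra.ι ℂ x -
        algebraMap ℂ (UniversalEnvelopingAlgebra ℂ G) (chi x)} := by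
  -- Modulo `posG D`, a bracket depends only on the degree zero components, where `chi` vanishes on
  -- brackets.
  have hlie : ∀ x ∈ wt D G 0 ⊔ posG D, ∀ y ∈ wt D G 0 ⊔ posG D,
      ∃ z ∈ wt D G 0, ∃ p ∈ posG D, chi z = 0 ∧ ⁅x, y⁆ = z + p := by
    intro x hx y hy
    obtain ⟨z, hz, p, hp, rfl⟩ := Submodule.mem_sup.1 hx
    obtain ⟨z', hz', p', hp', rfl⟩ := Submodule.mem_sup.1 hy
    refine ⟨⁅z, z'⁆, by simpa using lie_mem_wt hz hz', ⁅z, p'⁆ + ⁅p, z'⁆ + ⁅p, p'⁆, ?_,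
      hzero z hz z' hz', ?_⟩
    · refine add_mem (add_mem (zero_lie_posG hz hp') ?_) (posG_lie_posG hp hp')
      rw [← lie_skew]
      exact neg_mem (zero_lie_posG hz' hp)
    · simp only [add_lie, lie_add]; abel
  refine one_notMem_span (n := negSubalgebra D)
    ⟨disjoint_negG, codisjoint_iff.2 (by rw [← sup_assoc]; exact htop)⟩ ?_ ?_
  · intro x hx y hy
    obtain ⟨z, hz, p, hp, -, h⟩ := hlie x hx y hy
    rw [h]
    exact Submodule.add_mem_sup hz hp
  · intro x hx y hy
    obtain ⟨z, hz, p, hp, h0, h⟩ := hlie x hx y hy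
    rw [h, map_add, h0, hpos p hp, add_zero]

end Decomposition

end GradedLie

namespace DoubleAffine

open GradedLie LieAlgebra LieAlgebra.IsKilling

variable {g : Type*} [LieRing g] [LieAlgebra ℂ g] (B : InvariantForm g) {H : LieSubalgebra ℂ g}
variable [FiniteDimensional ℂ g] [IsKilling ℂ g] [H.IsCartanSubalgebra]
  (b : (rootSystem H).Base)

variable {B} in
-- The Cartan subalgebra is abelian and the degree in `t₁` is zero, so only the `c₂`-term of the
-- cocycle survives. Hence a functional vanishing on `c₂` is a character of `zeroPart`.
lemma zeroPart_lie_zeroPart {X Y : Toroidal B} (hX : X ∈ zeroPart B H) (hY : Y ∈ zeroPart B H) :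
    ⁅X, Y⁆ ∈ Submodule.span ℂ {c₂ B} := by
  have step : ∀ {Y : Toroidal B}, (∀ (h : H) (n : ℤ), ⁅elt B (h : g) (mono 0 n), Y⁆ ∈
      Submodule.span ℂ {c₂ B}) → ⁅d₁ B, Y⁆ ∈ Submodule.span ℂ {c₂ B} → ∀ X ∈ zeroPart B H,
      ⁅X, Y⁆ ∈ Submodule.span ℂ {c₂ B} := by
    intro Y h hd X hX
    suffices zeroPart B H ≤ (Submodule.span ℂ {c₂ B}).comap
        ((LieModule.toEnd ℂ (Toroidal B) (Toroidal B) :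
          Toroidal B →ₗ[ℂ] Module.End ℂ (Toroidal B)).flip Y) from this hX
    rw [zeroPart, Submodule.span_le]
    rintro X (⟨h', hh', f, rfl⟩ | hX)
    · rw [← one_mul (inclT₂ f), ← mono_zero_zero]
      exact elt_mul_inclT₂_mem (fun n => h ⟨h', hh'⟩ n) f
    · change ⁅X, Y⁆ ∈ Submodule.span ℂ {c₂ B}
      rcases hX with rfl | rfl | rfl
      · rw [c₁_lie]; exact zero_mem _
      · rw [c₂_lie]; exact zero_mem _
      · exact hd
  have hd : ∀ (h : H) (n : ℤ), ⁅d₁ B, elt B (h : g) (mono 0 n)⁆ = 0 := fun h n => by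
    rw [d₁_lie_elt, Int.cast_zero, zero_smul]
  refine step (fun h n => ?_) ?_ X hX
  · rw [← lie_skew]
    refine neg_mem (step (fun h' n' => ?_) ?_ Y hY)
    · rw [elt_lie_elt, cartan_lie, ← eltHom_apply]
      simp only [map_zero, LinearMap.zero_apply, zero_add, Int.cast_zero, zero_smul]
      exact Submodule.smul_mem _ _ (Submodule.smul_mem _ _ (Submodule.mem_span_singleton_self _))
    · rw [hd]; exact zero_mem _
  · rw [← lie_skew]
    refine neg_mem (step (fun h' n' => ?_) ?_ Y hY)
    · rw [← lie_skew, hd, neg_zero]; exact zero_mem _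
    · rw [lie_self]; exact zero_mem _

end DoubleAffine

end

/-! ### The modules `M(λ)` and `L(λ)` -/

noncomputable section

namespace DoubleAffine

open GradedLie LieAlgebra LieAlgebra.IsKilling

variable {g : Type*} [LieRing g] [LieAlgebra ℂ g] (B : InvariantForm g) {H : LieSubalgebra ℂ g}
variable [FiniteDimensional ℂ g] [IsKilling ℂ g] [H.IsCartanSubalgebra]
  (b : (rootSystem H).Base) (lam : Module.Dual ℂ (zeroPart B H))

/-- `Toroidal B` acts on `M(λ)` through its enveloping algebra. -/
instance : LieRingModule (Toroidal B) (Verma B b lam) where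
  bracket X v := UniversalEnvelopingAlgebra.ι ℂ X • v
  add_lie X Y v := by
    change UniversalEnvelopingAlgebra.ι ℂ (X + Y) • v = _
    rw [map_add, add_smul]
  lie_add X v w := smul_add _ v w
  leibniz_lie X Y v := by
    change UniversalEnvelopingAlgebra.ι ℂ X • UniversalEnvelopingAlgebra.ι ℂ Y • v =
      UniversalEnvelopingAlgebra.ι ℂ ⁅X, Y⁆ • v +
        UniversalEnvelopingAlgebra.ι ℂ Y • UniversalEnvelopingAlgebra.ι ℂ X • v
    let _ : LieRing (UniversalEnvelopingAlgebra ℂ (Toroidal B)) := LieRing.ofAssociativeRing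
    rw [LieHom.map_lie, LieRing.of_associative_ring_bracket, sub_smul, mul_smul, mul_smul,
      sub_add_cancel]

instance : LieModule ℂ (Toroidal B) (Verma B b lam) where
  smul_lie r X v := by
    change UniversalEnvelopingAlgebra.ι ℂ (r • X) • v = r • UniversalEnvelopingAlgebra.ι ℂ X • v
    rw [map_smul, smul_assoc]
  lie_smul r X v := by
    change UniversalEnvelopingAlgebra.ι ℂ X • r • v = r • UniversalEnvelopingAlgebra.ι ℂ X • v
    rw [← algebraMap_smul (UniversalEnvelopingAlgebra ℂ (Toroidal B)) r v,
      ← algebraMap_smul (UniversalEnvelopingAlgebra ℂ (Toroidal B)) r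
        (UniversalEnvelopingAlgebra.ι ℂ X • v), ← mul_smul, ← mul_smul, Algebra.commutes]

/-- The highest weight vector of `M(λ)`. -/
def vermaVec : Verma B b lam := (vermaIdeal B b lam).mkQ 1

/-- The quotient map from `M(λ)` to `L(λ)`. -/
def irrMk : Verma B b lam →ₗ[UniversalEnvelopingAlgebra ℂ (Toroidal B)] Irr B b lam :=
  (maxSubmodule B b lam).mkQ

lemma irrMk_surjective : Function.Surjective (irrMk B b lam) :=
  (maxSubmodule B b lam).mkQ_surjective

lemma ker_irrMk : LinearMap.ker (irrMk B b lam) = maxSubmodule B b lam :=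
  (maxSubmodule B b lam).ker_mkQ

/-- The highest weight vector of `L(λ)`. -/
def irrVec : Irr B b lam := irrMk B b lam (vermaVec B b lam)

variable {B lam}

lemma smul_vermaVec (u : UniversalEnvelopingAlgebra ℂ (Toroidal B)) :
    u • vermaVec B b lam = (vermaIdeal B b lam).mkQ u := by
  rw [vermaVec, ← map_smul, smul_eq_mul, mul_one]

lemma vermaVec_posPart {X : Toroidal B} (hX : X ∈ posPart B b) : ⁅X, vermaVec B b lam⁆ = 0 := by
  change UniversalEnvelopingAlgebra.ι ℂ X • vermaVec B b lam = 0
  rw [smul_vermaVec, Submodule.mkQ_apply, Submodule.Quotient.mk_eq_zero]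
  exact Submodule.subset_span (Or.inl ⟨X, hX, rfl⟩)

lemma vermaVec_zeroPart (X : zeroPart B H) :
    ⁅(X : Toroidal B), vermaVec B b lam⁆ = lam X • vermaVec B b lam := by
  change UniversalEnvelopingAlgebra.ι ℂ (X : Toroidal B) • vermaVec B b lam = _
  rw [← algebraMap_smul (UniversalEnvelopingAlgebra ℂ (Toroidal B)) (lam X), smul_vermaVec,
    smul_vermaVec, ← sub_eq_zero, ← map_sub, Submodule.mkQ_apply, Submodule.Quotient.mk_eq_zero]
  exact Submodule.subset_span (Or.inr ⟨X, rfl⟩)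

lemma vermaVec_gen (S : LieSubmodule ℂ (Toroidal B) (Verma B b lam)) (hS : vermaVec B b lam ∈ S) :
    S = ⊤ := by
  rw [eq_top_iff]
  intro x _
  obtain ⟨u, rfl⟩ := (vermaIdeal B b lam).mkQ_surjective x
  rw [← smul_vermaVec]
  exact mul_mem_of_ι_mul_mem (S := S.toSubmodule) (fun X w hw => S.lie_mem (x := X) hw) u hS

/-- The subspace underlying a submodule over the enveloping algebra. -/
def toLieSubmodule (N : Submodule (UniversalEnvelopingAlgebra ℂ (Toroidal B)) (Verma B b lam)) :
    LieSubmodule ℂ (Toroidal B) (Verma B b lam) :=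
  { N.restrictScalars ℂ with lie_mem := fun {X _} hm => N.smul_mem (UniversalEnvelopingAlgebra.ι ℂ X) hm }

lemma mem_toLieSubmodule
    {N : Submodule (UniversalEnvelopingAlgebra ℂ (Toroidal B)) (Verma B b lam)}
    {x : Verma B b lam} : x ∈ toLieSubmodule b N ↔ x ∈ N := Iff.rfl

variable {D : Toroidal B} {chi : Toroidal B →ₗ[ℂ] ℂ}
  (htop : negG D ⊔ wt D (Toroidal B) 0 ⊔ posG D = ⊤)
  (hv : IsHighestWeight D chi (vermaVec B b lam))

include htop hv

/-- Every proper submodule lies in the single subspace `lower`, so their sum does too and is still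
proper. -/
lemma vermaVec_notMem_maxSubmodule : vermaVec B b lam ∉ maxSubmodule B b lam := by
  intro h
  refine hv.notMem_lower ?_
  rw [maxSubmodule, sSup_eq_iSup'] at h
  refine Submodule.iSup_induction _ (motive := fun x => x ∈ lower D (Verma B b lam) (chi D)) h ?_
    (zero_mem _) (fun x y hx hy => add_mem hx hy)
  rintro ⟨N, hN⟩ x hx
  refine hv.le_lower_of_ne_top htop (N := toLieSubmodule b N) (fun hT => hN ?_) hx
  rw [eq_top_iff]
  intro y _
  rw [← mem_toLieSubmodule, hT]
  exact LieSubmodule.mem_top y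

lemma irr_isHighestWeight : IsHighestWeight D chi (irrVec B b lam) where
  ne_zero h := vermaVec_notMem_maxSubmodule b htop hv (by
    rwa [irrVec, ← LinearMap.mem_ker, ker_irrMk] at h)
  pos X hX := by
    change UniversalEnvelopingAlgebra.ι ℂ X • irrMk B b lam (vermaVec B b lam) = 0
    rw [← map_smul]
    exact (congrArg _ (hv.pos X hX)).trans (map_zero _)
  zero X hX := by
    change UniversalEnvelopingAlgebra.ι ℂ X • irrMk B b lam (vermaVec B b lam) =
      chi X • irrMk B b lam (vermaVec B b lam)
    rw [← algebraMap_smul (UniversalEnvelopingAlgebra ℂ (Toroidal B)) (chi X), ← map_smul,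
      ← map_smul, algebraMap_smul]
    exact congrArg _ (hv.zero X hX)
  gen S hS := by
    rw [eq_top_iff]
    intro x _
    obtain ⟨x, rfl⟩ := irrMk_surjective B b lam x
    obtain ⟨u, rfl⟩ := (vermaIdeal B b lam).mkQ_surjective x
    rw [← smul_vermaVec, map_smul]
    exact mul_mem_of_ι_mul_mem (S := S.toSubmodule) (fun X w hw => S.lie_mem (x := X) hw) u hS

/-- The preimage of `S` in `M(λ)` is either everything or proper, and in the latter case it is
contained in the kernel of the quotient map. -/
lemma irr_irreducible (S : LieSubmodule ℂ (Toroidal B) (Irr B b lam)) : S = ⊥ ∨ S = ⊤ := by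
  let N : Submodule (UniversalEnvelopingAlgebra ℂ (Toroidal B)) (Verma B b lam) :=
    { carrier := {x | irrMk B b lam x ∈ S}
      add_mem' := fun ha hb => by
        rw [Set.mem_ofPred_eq, map_add]
        exact add_mem ha hb
      zero_mem' := by
        rw [Set.mem_ofPred_eq, map_zero]
        exact zero_mem _
      smul_mem' := fun u x hx => by
        rw [Set.mem_ofPred_eq, map_smul]
        exact mul_mem_of_ι_mul_mem (S := S.toSubmodule) (fun X w hw => S.lie_mem (x := X) hw) u hx }
  by_cases hN : N = ⊤
  · right
    have : vermaVec B b lam ∈ N := hN ▸ Submodule.mem_top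
    exact (irr_isHighestWeight b htop hv).gen S this
  · left
    rw [eq_bot_iff]
    intro x hx
    obtain ⟨x, rfl⟩ := irrMk_surjective B b lam x
    have h0 : N ≤ maxSubmodule B b lam := le_sSup hN
    have h1 : x ∈ maxSubmodule B b lam := h0 hx
    rw [← ker_irrMk, LinearMap.mem_ker] at h1
    rw [h1]
    exact zero_mem _

attribute [local instance] LieRing.ofAssociativeRing in
/-- An irreducible highest weight module of highest weight `λ` is isomorphic to `L(λ)`. -/
theorem nonempty_irr_equiv {T : Type*} [AddCommGroup T] [Module ℂ T] [LieRingModule (Toroidal B) T]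
    [LieModule ℂ (Toroidal B) T] (hirr : ∀ S : LieSubmodule ℂ (Toroidal B) T, S = ⊥ ∨ S = ⊤) {t : T}
    (ht : t ≠ 0) (htpos : ∀ X ∈ posPart B b, ⁅X, t⁆ = 0)
    (htzero : ∀ X : zeroPart B H, ⁅(X : Toroidal B), t⁆ = lam X • t) :
    Nonempty (Irr B b lam ≃ₗ⁅ℂ, Toroidal B⁆ T) := by
  let Φ := UniversalEnvelopingAlgebra.lift ℂ (LieModule.toEnd ℂ (Toroidal B) T)
  let _ : Module (UniversalEnvelopingAlgebra ℂ (Toroidal B)) T := Module.compHom T Φ.toRingHom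
  have hι : ∀ (X : Toroidal B) (m : T), UniversalEnvelopingAlgebra.ι ℂ X • m = ⁅X, m⁆ := by
    intro X m
    change Φ (UniversalEnvelopingAlgebra.ι ℂ X) m = _
    rw [UniversalEnvelopingAlgebra.lift_ι_apply, LieModule.toEnd_apply_apply]
  have halg : ∀ (r : ℂ) (m : T),
      algebraMap ℂ (UniversalEnvelopingAlgebra ℂ (Toroidal B)) r • m = r • m := by
    intro r m
    change Φ (algebraMap ℂ _ r) m = _
    rw [AlgHom.commutes, Module.algebraMap_end_apply]
  have : IsScalarTower ℂ (UniversalEnvelopingAlgebra ℂ (Toroidal B)) T :=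
    ⟨fun r u m => by rw [Algebra.smul_def, mul_smul, halg]⟩
  let f : Verma B b lam →ₗ[UniversalEnvelopingAlgebra ℂ (Toroidal B)] T :=
    (vermaIdeal B b lam).liftQ (LinearMap.toSpanSingleton _ T t) (by
      rw [vermaIdeal, Submodule.span_le]
      rintro u (⟨X, hX, rfl⟩ | ⟨X, rfl⟩)
      · change UniversalEnvelopingAlgebra.ι ℂ X • t = 0
        rw [hι, htpos X hX]
      · change (UniversalEnvelopingAlgebra.ι ℂ (X : Toroidal B) - algebraMap ℂ _ (lam X)) • t = 0
        rw [sub_smul, hι, halg, htzero, sub_self])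
  have hft : f (vermaVec B b lam) = t := by
    change (1 : UniversalEnvelopingAlgebra ℂ (Toroidal B)) • t = t
    rw [one_smul]
  have himage : ∀ N : Submodule (UniversalEnvelopingAlgebra ℂ (Toroidal B)) (Verma B b lam),
      N.map f = ⊥ ∨ N.map f = ⊤ := by
    intro N
    let S : LieSubmodule ℂ (Toroidal B) T :=
      { (N.map f).restrictScalars ℂ with
        lie_mem := fun {X m} hm => by
          rw [← hι]
          exact (N.map f).smul_mem _ hm }
    have hS : ∀ x, x ∈ S ↔ x ∈ N.map f := fun x => Iff.rfl
    rcases hirr S with h | h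
    · left
      rw [eq_bot_iff]
      intro x hx
      rw [← hS, h, LieSubmodule.mem_bot] at hx
      exact hx
    · right
      rw [eq_top_iff]
      intro x _
      rw [← hS, h]
      exact LieSubmodule.mem_top x
  have hker : LinearMap.ker f ≤ maxSubmodule B b lam := le_sSup fun h => ht (by
    have : vermaVec B b lam ∈ LinearMap.ker f := h ▸ Submodule.mem_top
    rwa [LinearMap.mem_ker, hft] at this)
  have hsurj : Function.Surjective f := by
    rw [← LinearMap.range_eq_top, ← Submodule.map_top]
    refine (himage ⊤).resolve_left fun h => ht ?_
    have : t ∈ Submodule.map f ⊤ := ⟨_, Submodule.mem_top, hft⟩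
    rwa [h, Submodule.mem_bot] at this
  -- If the image were all of `T`, some `x` in the maximal submodule would map to `t`; the highest
  -- weight vector differs from `x` by an element of `ker f`, so it would lie in the maximal
  -- submodule too.
  have hmax : maxSubmodule B b lam ≤ LinearMap.ker f := by
    rcases himage (maxSubmodule B b lam) with h | h
    · intro x hx
      have : f x ∈ (maxSubmodule B b lam).map f := ⟨x, hx, rfl⟩
      rwa [h, Submodule.mem_bot] at this
    · exfalso
      have h1 : t ∈ (maxSubmodule B b lam).map f := h ▸ Submodule.mem_top
      obtain ⟨x, hx, hxt⟩ := h1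
      refine vermaVec_notMem_maxSubmodule b htop hv ?_
      have h2 : vermaVec B b lam - x ∈ maxSubmodule B b lam :=
        hker (by rw [LinearMap.mem_ker, map_sub, hft, hxt, sub_self])
      simpa using add_mem h2 hx
  let e : Irr B b lam ≃ₗ[UniversalEnvelopingAlgebra ℂ (Toroidal B)] T :=
    (Submodule.quotEquivOfEq _ _ (le_antisymm hmax hker)).trans (f.quotKerEquivOfSurjective hsurj)
  exact ⟨{ toFun := e
           map_add' := map_add e
           map_smul' := fun r x => by
             rw [← algebraMap_smul (UniversalEnvelopingAlgebra ℂ (Toroidal B)) r x, map_smul, halg]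
             rfl
           map_lie' := fun {X x} => by
             rw [← hι, ← map_smul]
             rfl
           invFun := e.symm
           left_inv := e.symm_apply_apply
           right_inv := e.apply_symm_apply }⟩

end DoubleAffine

end

noncomputable section

namespace DoubleAffine

open GradedLie LieAlgebra LieAlgebra.IsKilling

/-! ### Ideals of the toroidal algebra from ideals in `t₂`, and separation of factors -/

section Ideal

variable {g : Type*} [LieRing g] [LieAlgebra ℂ g] (B : InvariantForm g)

lemma deg₁_inclT₂ (f : ℂ[T;T⁻¹]) : deg₁ (inclT₂ f) = 0 := by
  induction f using LaurentPolynomial.induction_on' with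
  | add p q hp hq => rw [map_add, map_add, hp, hq, add_zero]
  | C_mul_T n a =>
    rw [← LaurentPolynomial.smul_eq_C_mul, map_smul, map_smul, inclT₂_T, mono, deg_single]
    simp

lemma deg₁_mono_mul (m : ℤ) (f : ℂ[T;T⁻¹]) :
    deg₁ (mono m 0 * inclT₂ f) = (m : ℂ) • (mono m 0 * inclT₂ f) := by
  rw [deg_mul, deg₁_inclT₂, mul_zero, add_zero, mono, deg_single, ← smul_mul_assoc,
    AddMonoidAlgebra.smul_single]
  rfl

lemma elt_lie_elt' (x y : g) (a c : Laurent₂) :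
    ⁅elt B x a, elt B y c⁆ = elt B ⁅x, y⁆ (a * c) +
      (cocycle B (AddMonoidHom.fst ℤ ℤ) (tens a x) (tens c y) • c₁ B +
        cocycle B (AddMonoidHom.snd ℤ ℤ) (tens a x) (tens c y) • c₂ B) := by
  ext <;> simp [Toroidal.lie_def, elt, c₁, c₂, lie_tens]

lemma d₁_lie_elt' (x : g) (a : Laurent₂) : ⁅d₁ B, elt B x a⁆ = elt B x (deg₁ a) := by
  ext <;> simp [Toroidal.lie_def, elt, d₁, loopDeg_tens]

/-- The elements `x ⊗ t₁^m f(t₂)` with `f` in the ideal `S`, and the central elements. -/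
def idealGen (S : Ideal ℂ[T;T⁻¹]) : Set (Toroidal B) :=
  {X | ∃ (x : g) (m : ℤ), ∃ f ∈ S, X = elt B x (mono m 0 * inclT₂ f)} ∪ {c₁ B, c₂ B}

variable {B} in
-- Multiplication keeps the `t₂`-factor in `S`, the cocycle only produces `c₁` and `c₂`, which is
-- why they are among the generators, and `d₁` merely rescales since it differentiates in `t₁`
-- alone.
lemma lie_mem_span_idealGen {S : Ideal ℂ[T;T⁻¹]} {Y : Toroidal B}
    (hY : Y ∈ Submodule.span ℂ (idealGen B S)) (X : Toroidal B) :
    ⁅X, Y⁆ ∈ Submodule.span ℂ (idealGen B S) := by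
  have hc₁ : c₁ B ∈ Submodule.span ℂ (idealGen B S) := Submodule.subset_span (Or.inr (by simp))
  have hc₂ : c₂ B ∈ Submodule.span ℂ (idealGen B S) := Submodule.subset_span (Or.inr (by simp))
  suffices Submodule.span ℂ (idealGen B S) ≤ (Submodule.span ℂ (idealGen B S)).comap
    (LieModule.toEnd ℂ (Toroidal B) (Toroidal B) X) from this hY
  rw [Submodule.span_le]
  rintro Y (⟨y, m, f, hf, rfl⟩ | hY)
  · change ⁅X, _⁆ ∈ Submodule.span ℂ (idealGen B S)
    have hf' : ∀ (y : g) (m : ℤ), ∀ f ∈ S, elt B y (mono m 0 * inclT₂ f) ∈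
        Submodule.span ℂ (idealGen B S) := fun y m f hf =>
      Submodule.subset_span (Or.inl ⟨y, m, f, hf, rfl⟩)
    rw [toroidal_eq B X, add_lie, add_lie, add_lie, smul_lie, smul_lie, smul_lie, c₁_lie, c₂_lie,
      smul_zero, smul_zero, add_zero, add_zero, d₁_lie_elt', deg₁_mono_mul,
      ← eltHom_apply B y ((m : ℂ) • _), map_smul, eltHom_apply]
    refine add_mem ?_ (Submodule.smul_mem _ _ (Submodule.smul_mem _ _ (hf' y m f hf)))
    refine loop_elt_mem B (S := (Submodule.span ℂ (idealGen B S)).comap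
      ((LieModule.toEnd ℂ (Toroidal B) (Toroidal B) :
        Toroidal B →ₗ[ℂ] Module.End ℂ (Toroidal B)).flip _)) (fun x m' n' => ?_) _
    change ⁅elt B x (mono m' n'), elt B y (mono m 0 * inclT₂ f)⁆ ∈ Submodule.span ℂ (idealGen B S)
    rw [elt_lie_elt', ← mono_mul_inclT₂_T, mul_mul_mul_comm, mono_mul_mono, add_zero, ← map_mul]
    exact add_mem (hf' _ _ _ (S.mul_mem_left _ hf))
      (add_mem (Submodule.smul_mem _ _ hc₁) (Submodule.smul_mem _ _ hc₂))
  · change ⁅X, Y⁆ ∈ Submodule.span ℂ (idealGen B S)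
    rcases hY with rfl | rfl
    · rw [lie_c₁]; exact zero_mem _
    · rw [lie_c₂]; exact zero_mem _

/-- The ideal `g ⊗ ℂ[t₁^{±1}] ⊗ S ⊕ ℂ c₁ ⊕ ℂ c₂` of `Toroidal B`. -/
def loopIdeal (S : Ideal ℂ[T;T⁻¹]) : LieIdeal ℂ (Toroidal B) :=
  { Submodule.span ℂ (idealGen B S) with lie_mem := fun {X _} hY => lie_mem_span_idealGen hY X }

lemma elt_mem_loopIdeal {S : Ideal ℂ[T;T⁻¹]} (x : g) (m : ℤ) {f : ℂ[T;T⁻¹]} (hf : f ∈ S) :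
    elt B x (mono m 0 * inclT₂ f) ∈ loopIdeal B S :=
  Submodule.subset_span (Or.inl ⟨x, m, f, hf, rfl⟩)

lemma c₁_mem_loopIdeal (S : Ideal ℂ[T;T⁻¹]) : c₁ B ∈ loopIdeal B S :=
  Submodule.subset_span (Or.inr (by simp))

lemma c₂_mem_loopIdeal (S : Ideal ℂ[T;T⁻¹]) : c₂ B ∈ loopIdeal B S :=
  Submodule.subset_span (Or.inr (by simp))

variable {B} in
/-- An element of `Toroidal B` without `d₁`-component acts on `V` in the same way as some element
that annihilates `W`. -/
lemma exists_separating {V W : Type*} [AddCommGroup V] [Module ℂ V] [LieRingModule (Toroidal B) V]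
    [LieModule ℂ (Toroidal B) V] [AddCommGroup W] [Module ℂ W] [LieRingModule (Toroidal B) W]
    [LieModule ℂ (Toroidal B) W] {S₁ S₂ : Ideal ℂ[T;T⁻¹]} (hS : IsCoprime S₁ S₂)
    (hV : ∀ X ∈ loopIdeal B S₁, ∀ x : V, ⁅X, x⁆ = 0)
    (hW : ∀ X ∈ loopIdeal B S₂, ∀ y : W, ⁅X, y⁆ = 0) {X : Toroidal B} (hX : X.coeffD₁ = 0) :
    ∃ Y : Toroidal B, (∀ x : V, ⁅Y, x⁆ = ⁅X, x⁆) ∧ ∀ y : W, ⁅Y, y⁆ = 0 := by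
  obtain ⟨e₁, he₁, e₂, he₂, he⟩ := Submodule.mem_sup.1
    ((Ideal.isCoprime_iff_sup_eq.1 hS) ▸ Submodule.mem_top : (1 : ℂ[T;T⁻¹]) ∈ S₁ ⊔ S₂)
  let Q : Submodule ℂ (Toroidal B) :=
    { carrier := {X | ∃ Y : Toroidal B, (∀ x : V, ⁅Y, x⁆ = ⁅X, x⁆) ∧ ∀ y : W, ⁅Y, y⁆ = 0}
      add_mem' := by
        rintro X X' ⟨Y, hY, hY'⟩ ⟨Z, hZ, hZ'⟩
        exact ⟨Y + Z, fun x => by rw [add_lie, add_lie, hY, hZ],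
          fun y => by rw [add_lie, hY', hZ', add_zero]⟩
      zero_mem' := ⟨0, fun x => rfl, fun y => zero_lie y⟩
      smul_mem' := by
        rintro r X ⟨Y, hY, hY'⟩
        exact ⟨r • Y, fun x => by rw [smul_lie, smul_lie, hY],
          fun y => by rw [smul_lie, hY', smul_zero]⟩ }
  have hc₁ : c₁ B ∈ Q :=
    ⟨0, fun x => by rw [zero_lie, hV _ (c₁_mem_loopIdeal B S₁)], fun y => zero_lie y⟩
  have hc₂ : c₂ B ∈ Q :=
    ⟨0, fun x => by rw [zero_lie, hV _ (c₂_mem_loopIdeal B S₁)], fun y => zero_lie y⟩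
  have hXQ : X ∈ Q := by
    rw [toroidal_eq B X, hX, zero_smul, add_zero]
    refine add_mem (add_mem (loop_elt_mem B (fun x m n => ?_) _) (Q.smul_mem _ hc₁))
      (Q.smul_mem _ hc₂)
    -- Multiplying by `e₂` lands in the ideal that kills `W`, and changes the element by its
    -- `e₁`-multiple, which kills `V`.
    refine ⟨elt B x (mono m 0 * inclT₂ (LaurentPolynomial.T n * e₂)), fun v => ?_,
      hW _ (elt_mem_loopIdeal B x m (S₂.mul_mem_left _ he₂))⟩
    have h1 : elt B x (mono m n) = elt B x (mono m 0 * inclT₂ (LaurentPolynomial.T n * e₁)) +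
        elt B x (mono m 0 * inclT₂ (LaurentPolynomial.T n * e₂)) := by
      rw [← eltHom_apply, ← eltHom_apply, ← eltHom_apply, ← map_add, ← mul_add, ← map_add,
        ← mul_add, he, mul_one, mono_mul_inclT₂_T]
    rw [h1, add_lie, hV _ (elt_mem_loopIdeal B x m (S₁.mul_mem_left _ he₁)), zero_add]
  exact hXQ

variable {B} in
/-- Extension of a functional on `zeroPart B H` by zero on the positive part. -/
lemma exists_extension {H : LieSubalgebra ℂ g} {D : Toroidal B} (hZ : zeroPart B H ≤ wt D (Toroidal B) 0)
    (lam : Module.Dual ℂ (zeroPart B H)) : ∃ chi : Toroidal B →ₗ[ℂ] ℂ,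
      (∀ X : zeroPart B H, chi X = lam X) ∧ ∀ X ∈ posG D, chi X = 0 := by
  obtain ⟨Q, hQ, hc⟩ := (disjoint_wt_posG (D := D)).symm.mono_right hZ |>.exists_isCompl
  refine ⟨LinearMap.ofIsCompl hc.symm lam 0, fun X => LinearMap.ofIsCompl_apply_left hc.symm X,
    fun X hX => LinearMap.ofIsCompl_apply_right hc.symm ⟨X, hQ hX⟩⟩

end Ideal

/-! ### Annihilators of `L(λ)` and the tensor product theorem -/

section Irr

variable {g : Type*} [LieRing g] [LieAlgebra ℂ g] {B : InvariantForm g} {H : LieSubalgebra ℂ g}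
variable [FiniteDimensional ℂ g] [IsKilling ℂ g] [H.IsCartanSubalgebra]
  (b : (rootSystem H).Base) {lam mu : Module.Dual ℂ (zeroPart B H)}

variable {D : Toroidal B} {chi : Toroidal B →ₗ[ℂ] ℂ} (hZ : zeroPart B H = wt D (Toroidal B) 0)
  (hP : posPart B b = posG D) (htop : negG D ⊔ wt D (Toroidal B) 0 ⊔ posG D = ⊤)
  (hchi : ∀ X : zeroPart B H, chi X = lam X) (hpos : ∀ X ∈ posG D, chi X = 0)

include hZ hP htop hchi hpos in
lemma verma_isHighestWeight (hc₂ : lam (zeroPart.c₂ B H) = 0) :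
    IsHighestWeight D chi (vermaVec B b lam) where
  ne_zero h := by
    have h1 : (1 : UniversalEnvelopingAlgebra ℂ (Toroidal B)) ∈ vermaIdeal B b lam := by
      rwa [vermaVec, Submodule.mkQ_apply, Submodule.Quotient.mk_eq_zero] at h
    refine one_notMem_span_of_grading htop hpos (fun X hX Y hY => ?_) (Submodule.span_mono ?_ h1)
    · rw [← hZ] at hX hY
      obtain ⟨r, hr⟩ := Submodule.mem_span_singleton.1 (zeroPart_lie_zeroPart hX hY)
      rw [← hr, map_smul, show c₂ B = (zeroPart.c₂ B H : Toroidal B) from rfl, hchi, hc₂, smul_zero]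
    · rintro u (⟨X, hX, rfl⟩ | ⟨X, rfl⟩)
      · rw [hP] at hX
        exact ⟨X, Submodule.mem_sup_right hX, by rw [hpos X hX, map_zero, sub_zero]⟩
      · exact ⟨X, Submodule.mem_sup_left (hZ ▸ X.2), by rw [hchi]⟩
  pos X hX := vermaVec_posPart b (hP ▸ hX)
  zero X hX := by
    rw [← hZ] at hX
    rw [show chi X = lam ⟨X, hX⟩ from hchi ⟨X, hX⟩]
    exact vermaVec_zeroPart b ⟨X, hX⟩
  gen := vermaVec_gen b

/-- The simple coroots form a basis of the Cartan subalgebra. -/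
lemma lam_cartan_eq_zero {S : Ideal ℂ[T;T⁻¹]} (hS : Annihilates B b S lam) (h : H) {f : ℂ[T;T⁻¹]}
    (hf : f ∈ S) : lam (zeroPart.cartan B h f) = 0 := by
  let φ : H →ₗ[ℂ] zeroPart B H :=
    LinearMap.codRestrict _ (((eltHom B).flip (inclT₂ f)) ∘ₗ H.toSubmodule.subtype) fun h =>
      (zeroPart.cartan B h f).2
  have : lam ∘ₗ φ = 0 := b.toCoweightBasis.ext fun p => by
    rw [RootPairing.Base.toCoweightBasis_apply]
    exact hS p p.2 f hf
  exact LinearMap.congr_fun this h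

/-- The ideal of `Toroidal B` defined by an ideal associated with `λ` annihilates `L(λ)`. -/
lemma loopIdeal_lie_irr {K : ℤ} {ρ : H} (hD : D = grader B K ρ)
    (hρ : ∀ α : H.root, (α : LieModule.Weight ℂ H g) ρ = (b.height α : ℂ))
    (hK₀ : 0 < K) (hK : ∀ α : H.root, |b.height α| < K)
    (hZ : zeroPart B H = wt D (Toroidal B) 0)
    (hP : posPart B b = posG D) (htop : negG D ⊔ wt D (Toroidal B) 0 ⊔ posG D = ⊤)
    (hchi : ∀ X : zeroPart B H, chi X = lam X)
    (hv : IsHighestWeight D chi (irrVec B b lam))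
    (hirr : ∀ S : LieSubmodule ℂ (Toroidal B) (Irr B b lam), S = ⊥ ∨ S = ⊤)
    (hc₁ : lam (zeroPart.c₁ B H) = 0) (hc₂ : lam (zeroPart.c₂ B H) = 0)
    {S : Ideal ℂ[T;T⁻¹]} (hS : Annihilates B b S lam) {X : Toroidal B} (hX : X ∈ loopIdeal B S)
    (x : Irr B b lam) : ⁅X, x⁆ = 0 := by
  refine hv.lie_eq_zero_of_mem_ideal htop hirr (fun X hX => ?_) hX x
  have hzero : ∀ X : zeroPart B H, lam X = 0 →
      ⁅(X : Toroidal B), irrVec B b lam⁆ ∈ lower D (Irr B b lam) (chi D) := fun X h0 => by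
    rw [hv.zero _ (hZ ▸ X.2), hchi, h0, zero_smul]
    exact zero_mem _
  have hor : ∀ {x : g} {m : ℤ}, ((∀ n, elt B x (mono m n) ∈ negG (grader B K (ρ : g))) ∨
      (∀ n, elt B x (mono m n) ∈ posPart B b)) → ∀ f, ⁅elt B x (mono m 0 * inclT₂ f),
        irrVec B b lam⁆ ∈ lower D (Irr B b lam) (chi D) := by
    rintro x m (h | h) f
    · rw [← hD] at h
      exact neg_lie_wt (elt_mul_inclT₂_mem h f) hv.mem_wt
    · rw [hv.pos _ (hP ▸ elt_mul_inclT₂_mem h f)]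
      exact zero_mem _
  suffices Submodule.span ℂ (idealGen B S) ≤ (lower D (Irr B b lam) (chi D)).comap
    ((LieModule.toEnd ℂ (Toroidal B) (Irr B b lam) :
        Toroidal B →ₗ[ℂ] Module.End ℂ (Irr B b lam)).flip (irrVec B b lam)) from this hX
  rw [Submodule.span_le]
  rintro Y (⟨y, m, f, hf, rfl⟩ | hY)
  · refine root_induction (H := H) (S := ((lower D (Irr B b lam) (chi D)).comap
      ((LieModule.toEnd ℂ (Toroidal B) (Irr B b lam) :
        Toroidal B →ₗ[ℂ] Module.End ℂ (Irr B b lam)).flip (irrVec B b lam))).comap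
      ((eltHom B).flip (mono m 0 * inclT₂ f))) (fun h => ?_) (fun α x hx => ?_) y
    -- Only in degree zero does `λ` enter: there the element acts on the highest weight vector by
    -- `λ(h ⊗ f) = 0`. All other generators of the form `x ⊗ t₁^m f` lower the vector or kill it.
    · by_cases hm : m = 0
      · subst hm
        have : ⁅elt B (h : g) (inclT₂ f), irrVec B b lam⁆ ∈ lower D (Irr B b lam) (chi D) :=
          hzero (zeroPart.cartan B h f) (lam_cartan_eq_zero b hS h hf)
        rwa [← one_mul (inclT₂ f), ← mono_zero_zero] at this
      · exact hor (cartan_mem_negG_or b hK₀ h hm) f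
    · exact hor (elt_mem_negG_or b hρ hK₀ hK α hx m) f
  · rcases hY with rfl | rfl
    · exact hzero (zeroPart.c₁ B H) hc₁
    · exact hzero (zeroPart.c₂ B H) hc₂

/-- `L(λ + μ) ≅ L(λ) ⊗ L(μ)` for functionals vanishing on the centre with coprime associated
ideals. -/
theorem nonempty_irr_add_equiv (hlam₁ : lam (zeroPart.c₁ B H) = 0)
    (hlam₂ : lam (zeroPart.c₂ B H) = 0) (hmu₁ : mu (zeroPart.c₁ B H) = 0)
    (hmu₂ : mu (zeroPart.c₂ B H) = 0) {S₁ S₂ : Ideal ℂ[T;T⁻¹]} (hS : IsCoprime S₁ S₂)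
    (hlamS : Annihilates B b S₁ lam) (hmuS : Annihilates B b S₂ mu) :
    Nonempty (Irr B b (lam + mu) ≃ₗ⁅ℂ, Toroidal B⁆ Irr B b lam ⊗[ℂ] Irr B b mu) := by
  obtain ⟨ρ, hρ⟩ := exists_height_vector b
  obtain ⟨K, hK₀, hK⟩ := exists_height_bound b
  obtain ⟨D, hD⟩ : ∃ D, D = grader B K (ρ : g) := ⟨_, rfl⟩
  have hZ' : zeroPart B H ≤ wt D (Toroidal B) 0 := hD ▸ zeroPart_le_wt
  have htop' : negG D ⊔ zeroPart B H ⊔ posPart B b = ⊤ :=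
    hD ▸ negG_sup_zeroPart_sup_posPart b hρ hK₀ hK
  obtain ⟨hZ, hP⟩ := eq_of_sup_eq_top hZ' (hD ▸ posPart_le_posG b hρ hK₀ hK) htop'
  have htop : negG D ⊔ wt D (Toroidal B) 0 ⊔ posG D = ⊤ := by rw [← hZ, ← hP]; exact htop'
  obtain ⟨chi, hchi, hchi'⟩ := exists_extension hZ' lam
  obtain ⟨psi, hpsi, hpsi'⟩ := exists_extension hZ' mu
  have hVl := verma_isHighestWeight b hZ hP htop hchi hchi' hlam₂
  have hVm := verma_isHighestWeight b hZ hP htop hpsi hpsi' hmu₂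
  have hVs := verma_isHighestWeight b (lam := lam + mu) (chi := chi + psi) hZ hP htop
    (fun X => by rw [LinearMap.add_apply, LinearMap.add_apply, hchi, hpsi])
    (fun X hX => by rw [LinearMap.add_apply, hchi' X hX, hpsi' X hX, add_zero])
    (by rw [LinearMap.add_apply, hlam₂, hmu₂, add_zero])
  have hl := irr_isHighestWeight b htop hVl
  have hm := irr_isHighestWeight b htop hVm
  have hirr := tensor_irreducible (A := LinearMap.ker
      ({ toFun := Toroidal.coeffD₁, map_add' := fun _ _ => rfl, map_smul' := fun _ _ => rfl } :
        Toroidal B →ₗ[ℂ] ℂ)) hl htop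
    (irr_irreducible b htop hVl) (irr_irreducible b htop hVm)
    (by
      rw [← hP, posPart, Submodule.span_le]
      rintro _ (⟨x, m, n, -, rfl⟩ | ⟨α, x, n, -, -, rfl⟩) <;> rfl)
    -- `D` has `d₁`-coefficient `K ≠ 0`, so subtracting this multiple of `D` removes the
    -- `d₁`-component of `X`.
    (fun X => ⟨X.coeffD₁ / K, by
      have hDK : D.coeffD₁ = K := by rw [hD]; simp [grader, d₁, elt]
      have hK' : (K : ℂ) ≠ 0 := by exact_mod_cast hK₀.ne'
      rw [LinearMap.mem_ker, map_sub, map_smul]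
      change X.coeffD₁ - X.coeffD₁ / K * D.coeffD₁ = 0
      rw [hDK, div_mul_cancel₀ _ hK', sub_self]⟩)
    (fun X hX => exists_separating hS
      (fun Y hY => loopIdeal_lie_irr b hD hρ hK₀ hK hZ hP htop hchi hl (irr_irreducible b htop hVl)
        hlam₁ hlam₂ hlamS hY)
      (fun Y hY => loopIdeal_lie_irr b hD hρ hK₀ hK hZ hP htop hpsi hm (irr_irreducible b htop hVm)
        hmu₁ hmu₂ hmuS hY) hX)
  have ht := hl.tmul hm hirr
  exact nonempty_irr_equiv b htop hVs hirr ht.ne_zero (fun X hX => ht.pos X (hP ▸ hX)) fun X => by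
    rw [ht.zero X (hZ ▸ X.2), LinearMap.add_apply, LinearMap.add_apply, hchi, hpsi]

end Irr

end DoubleAffine

end

theorem mainTheorem10 {g : Type*} [LieRing g] [LieAlgebra ℂ g] [FiniteDimensional ℂ g]
    [LieAlgebra.IsSimple ℂ g] (B : DoubleAffine.InvariantForm g)
    (H : LieSubalgebra ℂ g) [H.IsCartanSubalgebra]
    (b : (LieAlgebra.IsKilling.rootSystem H).Base) (hb : b.cartanMatrix.IsSimplyLaced)
    (S₁ S₂ : Ideal (LaurentPolynomial ℂ)) (hS : IsCoprime S₁ S₂)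
    (hS₁ : FiniteDimensional ℂ (LaurentPolynomial ℂ ⧸ S₁))
    (hS₂ : FiniteDimensional ℂ (LaurentPolynomial ℂ ⧸ S₂))
    (lam mu : Module.Dual ℂ (DoubleAffine.zeroPart B H))
    (hlam : DoubleAffine.IsExpPolynomial B b lam) (hmu : DoubleAffine.IsExpPolynomial B b mu)
    (hlamS : DoubleAffine.Annihilates B b S₁ lam) (hmuS : DoubleAffine.Annihilates B b S₂ mu) :
    Nonempty (DoubleAffine.Irr B b (lam + mu) ≃ₗ⁅ℂ, DoubleAffine.Toroidal B⁆
      TensorProduct ℂ (DoubleAffine.Irr B b lam) (DoubleAffine.Irr B b mu)) :=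
  DoubleAffine.nonempty_irr_add_equiv b hlam.1 hlam.2.1 hmu.1 hmu.2.1 hS hlamS hmuS
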